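/- **Nilpotent 5-dimensional complex Lie algebras.** Fix the basis $e_1,\dots,e_5$ of $\mathbb C^5$ and let $\psi^{jk}_i$ ($j\neq k$) be the alternating bilinear map $\mathbb C^5\times\mathbb C^5\to\mathbb C^5$ with $(e_j,e_k)\mapsto e_i$, $(e_k,e_j)\mapsto -e_i$ and all other pairs of basis vectors sent to $0$. For all complex parameters the following brackets are Lie algebra structures on $\mathbb C^5$: \begin{align*} d_5(p:q:r)&=\psi^{24}_1+p\psi^{24}_2+\psi^{34}_2+q\psi^{34}_3+(q-r)p\,\psi^{15}_1+(r-q)\psi^{25}_1+\psi^{35}_1+r\psi^{35}_2-r(p-q)\psi^{35}_3,\\ d_6(p:q)&=\psi^{24}_1+p\psi^{24}_2+\psi^{34}_2+q\psi^{34}_3-p\psi^{15}_1+\psi^{25}_1+\psi^{35}_2+(q-p)\psi^{35}_3,\\ d_9(p:q)&=\psi^{23}_1+\psi^{34}_2+(2p+q)\psi^{15}_1+(p+q)\psi^{25}_2+p\psi^{35}_3+\psi^{35}_4+\psi^{45}_1+q\psi^{45}_4,\\ d_{12}(p:q:r)&=\psi^{34}_2+p\psi^{15}_1+\psi^{15}_2+(q+r)\psi^{25}_2+\psi^{35}_1+q\psi^{35}_3+\psi^{45}_3+r\psi^{45}_4,\\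 d_{13}(p:q)&=\psi^{34}_2+(p+q)\psi^{15}_1+(p+q)\psi^{25}_2+\psi^{35}_1+p\psi^{35}_3+\psi^{45}_3+q\psi^{45}_4,\\ d_{14}(p:q)&=\psi^{34}_2+p\psi^{15}_1+\psi^{15}_2+(p+q)\psi^{25}_2+\psi^{35}_1+q\psi^{35}_3+\psi^{35}_4+p\psi^{45}_4,\\ d_{15}(p:q)&=\psi^{34}_2+p\psi^{15}_1+\psi^{15}_2+2q\psi^{25}_2+\psi^{35}_1+q\psi^{35}_3+q\psi^{45}_4,\\ d_{19}&=\psi^{34}_2+\psi^{15}_2,\\ d_{20}(p:q:r:s)&=p\psi^{15}_1+\psi^{25}_1+q\psi^{25}_2+\psi^{35}_2+r\psi^{35}_3+\psi^{45}_3+s\psi^{45}_4,\\ d_{21}(p:q:r)&=p\psi^{15}_1+p\psi^{25}_2+\psi^{35}_2+q\psi^{35}_3+\psi^{45}_3+r\psi^{45}_4,\\ d_{22}(p:q)&=p\psi^{15}_1+\psi^{25}_1+q\psi^{25}_2+p\psi^{35}_3+\psi^{45}_3+q\psi^{45}_4,\\ d_{23}(p:q)&=p\psi^{15}_1+p\psi^{25}_2+p\psi^{35}_3+\psi^{45}_3+q\psi^{45}_4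 . \end{align*} The eleven parametrized ones are called the *families*; the *generic element* of a family is its member with all parameters $0$. Then: 1. The nine Lie algebras $d_5(0:0:0)$, $d_{21}(0:0:0)$, $d_{12}(0:0:0)$, $d_{13}(0:0)$, $d_{19}$, $d_{20}(0:0:0:0)$, $d_{22}(0:0)$, $d_{23}(0:0)$ and the trivial (abelian) one are nilpotent and pairwise nonisomorphic, and every nilpotent 5-dimensional complex Lie algebra is isomorphic to one of them; so there are exactly 9 up to isomorphism. Among the nine, exactly $d_{21}(0:0:0)$, $d_{23}(0:0)$ and the trivial one are decomposable (a direct sum of two nonzero ideals), so 6 are indecomposable. 2. All members of the families are solvable, and the generic element of each family is nilpotent. 3. $d_5(0:0:0)\cong d_{14}(0:0)\cong d_{15}(0:0)$, $d_6(0:0)\cong d_{21}(0:0:0)$ and $d_9(0:0)\cong d_{12}(0:0:0)$. 4. $d_{19}$ is not isomorphic to any member of a family, and a nilpotent 5-dimensional complex Lie algebra is isomorphic to the generic element of some family if and only if it is neither abelian nor isomorphic to $d_{19}$. -/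

import Mathlib

noncomputable section

namespace Lie5

/-- A complex Lie algebra structure on the vector space `ℂ⁵`. -/
structure LieStructure where
  /-- the bracket, as a bilinear map -/
  br : (Fin 5 → ℂ) →ₗ[ℂ] (Fin 5 → ℂ) →ₗ[ℂ] (Fin 5 → ℂ)
  br_self : ∀ x, br x x = 0
  jacobi : ∀ x y z, br x (br y z) = br (br x y) z + br y (br x z)

/-- The Lie algebra given by `d`: a copy of `ℂ⁵` that carries the bracket of `d`. -/
def LieStructure.Alg (_d : LieStructure) : Type := Fin 5 → ℂ

instance (d : LieStructure) : AddCommGroup d.Alg :=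
  inferInstanceAs (AddCommGroup (Fin 5 → ℂ))

instance (d : LieStructure) : Module ℂ d.Alg :=
  inferInstanceAs (Module ℂ (Fin 5 → ℂ))

instance (d : LieStructure) : LieRing d.Alg where
  bracket x y := d.br x y
  add_lie x y z := d.br.map_add₂ x y z
  lie_add x y z := (d.br x).map_add y z
  lie_self x := d.br_self x
  leibniz_lie x y z := d.jacobi x y z

instance (d : LieStructure) : LieAlgebra ℂ d.Alg where
  lie_smul t x y := (d.br x).map_smul t y

/-- The elementary cochain `ψ^{jk}_i`: it sends `(e_j, e_k)` to `e_i`, `(e_k, e_j)` to `-e_i` and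
all other pairs of basis vectors to `0`. The basis `e_1, …, e_5` of `ℂ⁵` is indexed by the residues
`1, 2, 3, 4, 5` modulo `5`, which are the elements of `Fin 5`; thus `e_5` sits at the index
`(5 : Fin 5) = 0`. -/
def psi (j k i : Fin 5) : (Fin 5 → ℂ) →ₗ[ℂ] (Fin 5 → ℂ) →ₗ[ℂ] (Fin 5 → ℂ) :=
  LinearMap.mk₂ ℂ (fun x y => (x j * y k - x k * y j) • (Pi.single i 1 : Fin 5 → ℂ))
    (fun x x' y => by rw [← add_smul]; congr 1; simp only [Pi.add_apply]; ring)
    (fun c x y => by rw [smul_smul]; congr 1; simp only [Pi.smul_apply, smul_eq_mul]; ring)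
    (fun x y y' => by rw [← add_smul]; congr 1; simp only [Pi.add_apply]; ring)
    (fun c x y => by rw [smul_smul]; congr 1; simp only [Pi.smul_apply, smul_eq_mul]; ring)

theorem psi_self (j k i : Fin 5) (x : Fin 5 → ℂ) : psi j k i x x = 0 := by
  simp [psi, mul_comm]

theorem psi_apply (j k i : Fin 5) (x y : Fin 5 → ℂ) (m : Fin 5) :
    psi j k i x y m = if m = i then x j * y k - x k * y j else 0 := by
  simp [psi, Pi.single_apply]

/-- The bracket of the family `d₅(p:q:r)`. -/
def d5Br (p q r : ℂ) : (Fin 5 → ℂ) →ₗ[ℂ] (Fin 5 → ℂ) →ₗ[ℂ] (Fin 5 → ℂ) :=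
  psi 2 4 1 + p • psi 2 4 2 + psi 3 4 2 + q • psi 3 4 3
    + ((q - r) * p) • psi 1 5 1 + (r - q) • psi 2 5 1 + psi 3 5 1
    + r • psi 3 5 2 - (r * (p - q)) • psi 3 5 3

theorem d5Br_apply (p q r : ℂ) (x y : Fin 5 → ℂ) : d5Br p q r x y =
    ![0,
      (x 2 * y 4 - x 4 * y 2) + ((q - r) * p) * (x 1 * y 0 - x 0 * y 1) + (r - q) * (x 2 * y 0 - x 0 * y 2) + (x 3 * y 0 - x 0 * y 3),
      p * (x 2 * y 4 - x 4 * y 2) + (x 3 * y 4 - x 4 * y 3) + r * (x 3 * y 0 - x 0 * y 3),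
      q * (x 3 * y 4 - x 4 * y 3) - (r * (p - q)) * (x 3 * y 0 - x 0 * y 3),
      0] := by
  ext i; fin_cases i <;> simp [d5Br, psi_apply]

/-- The family `d₅(p:q:r)`. -/
def d5 (p q r : ℂ) : LieStructure where
  br := d5Br p q r
  br_self x := by simp [d5Br, psi_self]
  jacobi x y z := by
    simp only [d5Br_apply]
    ext i; fin_cases i <;> simp <;> ring

/-- The bracket of the family `d₆(p:q)`. -/
def d6Br (p q : ℂ) : (Fin 5 → ℂ) →ₗ[ℂ] (Fin 5 → ℂ) →ₗ[ℂ] (Fin 5 → ℂ) :=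
  psi 2 4 1 + p • psi 2 4 2 + psi 3 4 2 + q • psi 3 4 3
    - p • psi 1 5 1 + psi 2 5 1 + psi 3 5 2 + (q - p) • psi 3 5 3

theorem d6Br_apply (p q : ℂ) (x y : Fin 5 → ℂ) : d6Br p q x y =
    ![0,
      (x 2 * y 4 - x 4 * y 2) - p * (x 1 * y 0 - x 0 * y 1) + (x 2 * y 0 - x 0 * y 2),
      p * (x 2 * y 4 - x 4 * y 2) + (x 3 * y 4 - x 4 * y 3) + (x 3 * y 0 - x 0 * y 3),
      q * (x 3 * y 4 - x 4 * y 3) + (q - p) * (x 3 * y 0 - x 0 * y 3),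
      0] := by
  ext i; fin_cases i <;> simp [d6Br, psi_apply]

/-- The family `d₆(p:q)`. -/
def d6 (p q : ℂ) : LieStructure where
  br := d6Br p q
  br_self x := by simp [d6Br, psi_self]
  jacobi x y z := by
    simp only [d6Br_apply]
    ext i; fin_cases i <;> simp <;> ring

/-- The bracket of the family `d₉(p:q)`. -/
def d9Br (p q : ℂ) : (Fin 5 → ℂ) →ₗ[ℂ] (Fin 5 → ℂ) →ₗ[ℂ] (Fin 5 → ℂ) :=
  psi 2 3 1 + psi 3 4 2 + (2 * p + q) • psi 1 5 1 + (p + q) • psi 2 5 2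
    + p • psi 3 5 3 + psi 3 5 4 + psi 4 5 1 + q • psi 4 5 4

theorem d9Br_apply (p q : ℂ) (x y : Fin 5 → ℂ) : d9Br p q x y =
    ![0,
      (x 2 * y 3 - x 3 * y 2) + (2 * p + q) * (x 1 * y 0 - x 0 * y 1) + (x 4 * y 0 - x 0 * y 4),
      (x 3 * y 4 - x 4 * y 3) + (p + q) * (x 2 * y 0 - x 0 * y 2),
      p * (x 3 * y 0 - x 0 * y 3),
      (x 3 * y 0 - x 0 * y 3) + q * (x 4 * y 0 - x 0 * y 4)] := by
  ext i; fin_cases i <;> simp [d9Br, psi_apply]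

/-- The family `d₉(p:q)`. -/
def d9 (p q : ℂ) : LieStructure where
  br := d9Br p q
  br_self x := by simp [d9Br, psi_self]
  jacobi x y z := by
    simp only [d9Br_apply]
    ext i; fin_cases i <;> simp <;> ring

/-- The bracket of the family `d₁₂(p:q:r)`. -/
def d12Br (p q r : ℂ) : (Fin 5 → ℂ) →ₗ[ℂ] (Fin 5 → ℂ) →ₗ[ℂ] (Fin 5 → ℂ) :=
  psi 3 4 2 + p • psi 1 5 1 + psi 1 5 2 + (q + r) • psi 2 5 2
    + psi 3 5 1 + q • psi 3 5 3 + psi 4 5 3 + r • psi 4 5 4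

theorem d12Br_apply (p q r : ℂ) (x y : Fin 5 → ℂ) : d12Br p q r x y =
    ![0,
      p * (x 1 * y 0 - x 0 * y 1) + (x 3 * y 0 - x 0 * y 3),
      (x 3 * y 4 - x 4 * y 3) + (x 1 * y 0 - x 0 * y 1) + (q + r) * (x 2 * y 0 - x 0 * y 2),
      q * (x 3 * y 0 - x 0 * y 3) + (x 4 * y 0 - x 0 * y 4),
      r * (x 4 * y 0 - x 0 * y 4)] := by
  ext i; fin_cases i <;> simp [d12Br, psi_apply]

/-- The family `d₁₂(p:q:r)`. -/
def d12 (p q r : ℂ) : LieStructure where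
  br := d12Br p q r
  br_self x := by simp [d12Br, psi_self]
  jacobi x y z := by
    simp only [d12Br_apply]
    ext i; fin_cases i <;> simp <;> ring

/-- The bracket of the family `d₁₃(p:q)`. -/
def d13Br (p q : ℂ) : (Fin 5 → ℂ) →ₗ[ℂ] (Fin 5 → ℂ) →ₗ[ℂ] (Fin 5 → ℂ) :=
  psi 3 4 2 + (p + q) • psi 1 5 1 + (p + q) • psi 2 5 2 + psi 3 5 1
    + p • psi 3 5 3 + psi 4 5 3 + q • psi 4 5 4

theorem d13Br_apply (p q : ℂ) (x y : Fin 5 → ℂ) : d13Br p q x y =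
    ![0,
      (p + q) * (x 1 * y 0 - x 0 * y 1) + (x 3 * y 0 - x 0 * y 3),
      (x 3 * y 4 - x 4 * y 3) + (p + q) * (x 2 * y 0 - x 0 * y 2),
      p * (x 3 * y 0 - x 0 * y 3) + (x 4 * y 0 - x 0 * y 4),
      q * (x 4 * y 0 - x 0 * y 4)] := by
  ext i; fin_cases i <;> simp [d13Br, psi_apply]

/-- The family `d₁₃(p:q)`. -/
def d13 (p q : ℂ) : LieStructure where
  br := d13Br p q
  br_self x := by simp [d13Br, psi_self]
  jacobi x y z := by
    simp only [d13Br_apply]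
    ext i; fin_cases i <;> simp <;> ring

/-- The bracket of the family `d₁₄(p:q)`. -/
def d14Br (p q : ℂ) : (Fin 5 → ℂ) →ₗ[ℂ] (Fin 5 → ℂ) →ₗ[ℂ] (Fin 5 → ℂ) :=
  psi 3 4 2 + p • psi 1 5 1 + psi 1 5 2 + (p + q) • psi 2 5 2
    + psi 3 5 1 + q • psi 3 5 3 + psi 3 5 4 + p • psi 4 5 4

theorem d14Br_apply (p q : ℂ) (x y : Fin 5 → ℂ) : d14Br p q x y =
    ![0,
      p * (x 1 * y 0 - x 0 * y 1) + (x 3 * y 0 - x 0 * y 3),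
      (x 3 * y 4 - x 4 * y 3) + (x 1 * y 0 - x 0 * y 1) + (p + q) * (x 2 * y 0 - x 0 * y 2),
      q * (x 3 * y 0 - x 0 * y 3),
      (x 3 * y 0 - x 0 * y 3) + p * (x 4 * y 0 - x 0 * y 4)] := by
  ext i; fin_cases i <;> simp [d14Br, psi_apply]

/-- The family `d₁₄(p:q)`. -/
def d14 (p q : ℂ) : LieStructure where
  br := d14Br p q
  br_self x := by simp [d14Br, psi_self]
  jacobi x y z := by
    simp only [d14Br_apply]
    ext i; fin_cases i <;> simp <;> ring

/-- The bracket of the family `d₁₅(p:q)`. -/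
def d15Br (p q : ℂ) : (Fin 5 → ℂ) →ₗ[ℂ] (Fin 5 → ℂ) →ₗ[ℂ] (Fin 5 → ℂ) :=
  psi 3 4 2 + p • psi 1 5 1 + psi 1 5 2 + (2 * q) • psi 2 5 2
    + psi 3 5 1 + q • psi 3 5 3 + q • psi 4 5 4

theorem d15Br_apply (p q : ℂ) (x y : Fin 5 → ℂ) : d15Br p q x y =
    ![0,
      p * (x 1 * y 0 - x 0 * y 1) + (x 3 * y 0 - x 0 * y 3),
      (x 3 * y 4 - x 4 * y 3) + (x 1 * y 0 - x 0 * y 1) + (2 * q) * (x 2 * y 0 - x 0 * y 2),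
      q * (x 3 * y 0 - x 0 * y 3),
      q * (x 4 * y 0 - x 0 * y 4)] := by
  ext i; fin_cases i <;> simp [d15Br, psi_apply]

/-- The family `d₁₅(p:q)`. -/
def d15 (p q : ℂ) : LieStructure where
  br := d15Br p q
  br_self x := by simp [d15Br, psi_self]
  jacobi x y z := by
    simp only [d15Br_apply]
    ext i; fin_cases i <;> simp <;> ring

/-- The bracket of the singleton `d₁₉`. -/
def d19Br : (Fin 5 → ℂ) →ₗ[ℂ] (Fin 5 → ℂ) →ₗ[ℂ] (Fin 5 → ℂ) :=
  psi 3 4 2 + psi 1 5 2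

theorem d19Br_apply (x y : Fin 5 → ℂ) : d19Br x y =
    ![0,
      0,
      (x 3 * y 4 - x 4 * y 3) + (x 1 * y 0 - x 0 * y 1),
      0,
      0] := by
  ext i; fin_cases i <;> simp [d19Br, psi_apply]

/-- The singleton `d₁₉`. -/
def d19 : LieStructure where
  br := d19Br
  br_self x := by simp [d19Br, psi_self]
  jacobi x y z := by
    simp only [d19Br_apply]
    ext i; fin_cases i <;> simp

/-- The bracket of the family `d₂₀(p:q:r:s)`. -/
def d20Br (p q r s : ℂ) : (Fin 5 → ℂ) →ₗ[ℂ] (Fin 5 → ℂ) →ₗ[ℂ] (Fin 5 → ℂ) :=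
  p • psi 1 5 1 + psi 2 5 1 + q • psi 2 5 2 + psi 3 5 2 + r • psi 3 5 3
    + psi 4 5 3 + s • psi 4 5 4

theorem d20Br_apply (p q r s : ℂ) (x y : Fin 5 → ℂ) : d20Br p q r s x y =
    ![0,
      p * (x 1 * y 0 - x 0 * y 1) + (x 2 * y 0 - x 0 * y 2),
      q * (x 2 * y 0 - x 0 * y 2) + (x 3 * y 0 - x 0 * y 3),
      r * (x 3 * y 0 - x 0 * y 3) + (x 4 * y 0 - x 0 * y 4),
      s * (x 4 * y 0 - x 0 * y 4)] := by
  ext i; fin_cases i <;> simp [d20Br, psi_apply]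

/-- The family `d₂₀(p:q:r:s)`. -/
def d20 (p q r s : ℂ) : LieStructure where
  br := d20Br p q r s
  br_self x := by simp [d20Br, psi_self]
  jacobi x y z := by
    simp only [d20Br_apply]
    ext i; fin_cases i <;> simp <;> ring

/-- The bracket of the family `d₂₁(p:q:r)`. -/
def d21Br (p q r : ℂ) : (Fin 5 → ℂ) →ₗ[ℂ] (Fin 5 → ℂ) →ₗ[ℂ] (Fin 5 → ℂ) :=
  p • psi 1 5 1 + p • psi 2 5 2 + psi 3 5 2 + q • psi 3 5 3 + psi 4 5 3 + r • psi 4 5 4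

theorem d21Br_apply (p q r : ℂ) (x y : Fin 5 → ℂ) : d21Br p q r x y =
    ![0,
      p * (x 1 * y 0 - x 0 * y 1),
      p * (x 2 * y 0 - x 0 * y 2) + (x 3 * y 0 - x 0 * y 3),
      q * (x 3 * y 0 - x 0 * y 3) + (x 4 * y 0 - x 0 * y 4),
      r * (x 4 * y 0 - x 0 * y 4)] := by
  ext i; fin_cases i <;> simp [d21Br, psi_apply]

/-- The family `d₂₁(p:q:r)`. -/
def d21 (p q r : ℂ) : LieStructure where
  br := d21Br p q r
  br_self x := by simp [d21Br, psi_self]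
  jacobi x y z := by
    simp only [d21Br_apply]
    ext i; fin_cases i <;> simp <;> ring

/-- The bracket of the family `d₂₂(p:q)`. -/
def d22Br (p q : ℂ) : (Fin 5 → ℂ) →ₗ[ℂ] (Fin 5 → ℂ) →ₗ[ℂ] (Fin 5 → ℂ) :=
  p • psi 1 5 1 + psi 2 5 1 + q • psi 2 5 2 + p • psi 3 5 3 + psi 4 5 3 + q • psi 4 5 4

theorem d22Br_apply (p q : ℂ) (x y : Fin 5 → ℂ) : d22Br p q x y =
    ![0,
      p * (x 1 * y 0 - x 0 * y 1) + (x 2 * y 0 - x 0 * y 2),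
      q * (x 2 * y 0 - x 0 * y 2),
      p * (x 3 * y 0 - x 0 * y 3) + (x 4 * y 0 - x 0 * y 4),
      q * (x 4 * y 0 - x 0 * y 4)] := by
  ext i; fin_cases i <;> simp [d22Br, psi_apply]

/-- The family `d₂₂(p:q)`. -/
def d22 (p q : ℂ) : LieStructure where
  br := d22Br p q
  br_self x := by simp [d22Br, psi_self]
  jacobi x y z := by
    simp only [d22Br_apply]
    ext i; fin_cases i <;> simp <;> ring

/-- The bracket of the family `d₂₃(p:q)`. -/
def d23Br (p q : ℂ) : (Fin 5 → ℂ) →ₗ[ℂ] (Fin 5 → ℂ) →ₗ[ℂ] (Fin 5 → ℂ) :=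
  p • psi 1 5 1 + p • psi 2 5 2 + p • psi 3 5 3 + psi 4 5 3 + q • psi 4 5 4

theorem d23Br_apply (p q : ℂ) (x y : Fin 5 → ℂ) : d23Br p q x y =
    ![0,
      p * (x 1 * y 0 - x 0 * y 1),
      p * (x 2 * y 0 - x 0 * y 2),
      p * (x 3 * y 0 - x 0 * y 3) + (x 4 * y 0 - x 0 * y 4),
      q * (x 4 * y 0 - x 0 * y 4)] := by
  ext i; fin_cases i <;> simp [d23Br, psi_apply]

/-- The family `d₂₃(p:q)`. -/
def d23 (p q : ℂ) : LieStructure where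
  br := d23Br p q
  br_self x := by simp [d23Br, psi_self]
  jacobi x y z := by
    simp only [d23Br_apply]
    ext i; fin_cases i <;> simp <;> ring

/-- The trivial (abelian) Lie algebra structure. -/
def trivialStructure : LieStructure where
  br := 0
  br_self _ := rfl
  jacobi _ _ _ := by simp

/-- The labels of the eleven non-singleton families of 5-dimensional solvable Lie algebras. -/
inductive Family where
  | f5 | f6 | f9 | f12 | f13 | f14 | f15 | f20 | f21 | f22 | f23

/-- The number of homogeneous parameters of a family. -/
def Family.arity : Family → ℕ
  | f5 => 3 | f6 => 2 | f9 => 2 | f12 => 3 | f13 => 2 | f14 => 2 | f15 => 2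
  | f20 => 4 | f21 => 3 | f22 => 2 | f23 => 2

/-- The member of a family with given homogeneous parameters. -/
def Family.member : (F : Family) → (Fin F.arity → ℂ) → LieStructure
  | f5, a => d5 (a (0 : Fin 3)) (a (1 : Fin 3)) (a (2 : Fin 3))
  | f6, a => d6 (a (0 : Fin 2)) (a (1 : Fin 2))
  | f9, a => d9 (a (0 : Fin 2)) (a (1 : Fin 2))
  | f12, a => d12 (a (0 : Fin 3)) (a (1 : Fin 3)) (a (2 : Fin 3))
  | f13, a => d13 (a (0 : Fin 2)) (a (1 : Fin 2))
  | f14, a => d14 (a (0 : Fin 2)) (a (1 : Fin 2))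
  | f15, a => d15 (a (0 : Fin 2)) (a (1 : Fin 2))
  | f20, a => d20 (a (0 : Fin 4)) (a (1 : Fin 4)) (a (2 : Fin 4)) (a (3 : Fin 4))
  | f21, a => d21 (a (0 : Fin 3)) (a (1 : Fin 3)) (a (2 : Fin 3))
  | f22, a => d22 (a (0 : Fin 2)) (a (1 : Fin 2))
  | f23, a => d23 (a (0 : Fin 2)) (a (1 : Fin 2))

/-- The generic element of a family: all homogeneous parameters are zero. -/
def Family.generic (F : Family) : LieStructure := F.member fun _ => 0

/-- The table of nilpotent structures, the trivial one last. With all parameters zero the brackets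
of the first eight are
`ψ^{24}_1 + ψ^{34}_2 + ψ^{35}_1`, `ψ^{35}_2 + ψ^{45}_3`,
`ψ^{34}_2 + ψ^{15}_2 + ψ^{35}_1 + ψ^{45}_3`, `ψ^{34}_2 + ψ^{35}_1 + ψ^{45}_3`,
`ψ^{34}_2 + ψ^{15}_2`, `ψ^{25}_1 + ψ^{35}_2 + ψ^{45}_3`, `ψ^{25}_1 + ψ^{45}_3`, `ψ^{45}_3`. -/
def nilpotentTable : Fin 9 → LieStructure :=
  ![d5 0 0 0, d21 0 0 0, d12 0 0 0, d13 0 0, d19, d20 0 0 0 0, d22 0 0, d23 0 0, trivialStructure]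

/-- Isomorphism of complex Lie algebras. -/
def Iso (L M : Type*) [LieRing L] [LieAlgebra ℂ L] [LieRing M] [LieAlgebra ℂ M] : Prop :=
  Nonempty (L ≃ₗ⁅ℂ⁆ M)

/-- A Lie algebra is decomposable if it is the direct sum of two nonzero ideals. -/
def IsDecomposable (L : Type*) [LieRing L] [LieAlgebra ℂ L] : Prop :=
  ∃ I J : LieIdeal ℂ L, I ≠ ⊥ ∧ J ≠ ⊥ ∧ IsCompl I J

end Lie5

end

/-!
Every nilpotent five-dimensional complex Lie algebra `L` is brought to normal form along its lower
central series `lcs L k`. The mechanism is `SpansModNext`: if a set spans `L` modulo `lcs L 1`, its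
iterated brackets span each `lcs L k` modulo `lcs L (k + 1)` (`SpansModNext.succ`), and the series
is strictly decreasing until it vanishes (`finrank_lcs_succ_lt`). A single generator would force the
derived algebra to be zero, so the derived algebra has dimension at most three
(`finrank_lcs_one_le_three`), and the dimension decides the number of generators.

* Dimension three: two generators `a`, `b`. If the class is three, their iterated brackets form a
  basis. If the class is four, `b` can be chosen with `⁅b, ⁅a, b⁆⁆` central, and the two normal forms
  differ by whether this element is zero (`exists_iso_table_of_finrank_three`).
* Dimension two: three generators. In class two, the three brackets of generators satisfy a linear
  relation, and every bivector in dimension three is decomposable, so two generators can be made to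
  commute. In class three, two of the generators centralize the derived algebra, and the Jacobi
  identity makes their bracket central (`exists_iso_table_of_finrank_two`).
* Dimension one: the bracket is an alternating form with values in a central line, of rank two or
  four (`exists_iso_table_of_finrank_one`).

In each case five vectors with prescribed brackets are found, and `iso_of_span` produces the
isomorphism. All scalings are rational, so no roots are needed.

The nine algebras are separated by invariants that are first-order statements about the bracket
(`eq_of_iso_table`). Decomposability is read off the center (`isDecomposable_table`): in a
decomposable nilpotent algebra of dimension five, a summand of dimension at most two is abelian and
therefore central, and it meets the derived algebra only in zero; this is impossible when every
central element is a bracket. The algebra `d₁₉` is the only one considered here whose derived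
algebra and center are both lines, which distinguishes it from all members of the families
(`not_iso_d19_member`).
-/

namespace Lie5

/-! ### Invariants separating the table -/

section Invariants

variable {L M : Type*} [LieRing L] [LieAlgebra ℂ L] [LieRing M] [LieAlgebra ℂ M]

/-- All left-normed triple brackets vanish: nilpotency class at most two. -/
def TripleVanish (L : Type*) [LieRing L] : Prop := ∀ x y z : L, ⁅⁅x, y⁆, z⁆ = 0

/-- All left-normed fourfold brackets vanish: nilpotency class at most three. -/
def QuadVanish (L : Type*) [LieRing L] : Prop := ∀ x y z w : L, ⁅⁅⁅x, y⁆, z⁆, w⁆ = 0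

/-- Every central element is a single bracket. For the algebras of the table this is equivalent to
indecomposability. -/
def CenterBrackets (L : Type*) [LieRing L] : Prop :=
  ∀ z : L, (∀ w : L, ⁅w, z⁆ = 0) → ∃ a b : L, ⁅a, b⁆ = z

/-- The center is at most one-dimensional. -/
def CenterLine (L : Type*) [LieRing L] [LieAlgebra ℂ L] : Prop :=
  ∃ v : L, ∀ z : L, (∀ w : L, ⁅w, z⁆ = 0) → ∃ c : ℂ, z = c • v

/-- Some `x` centralizes the derived algebra and has `⁅⁅⁅x, y⁆, y⁆, y⁆ ≠ 0` for some `y`. This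
separates the two algebras of the table of nilpotency class four. -/
def EngelElement (L : Type*) [LieRing L] : Prop :=
  ∃ x y : L, (∀ a b : L, ⁅x, ⁅a, b⁆⁆ = 0) ∧ ⁅⁅⁅x, y⁆, y⁆, y⁆ ≠ 0

/-- The derived algebra is at most one-dimensional. -/
def DerivedLine (L : Type*) [LieRing L] [LieAlgebra ℂ L] : Prop :=
  ∃ v : L, ∀ x y : L, ∃ c : ℂ, ⁅x, y⁆ = c • v

theorem Iso.symm (h : Iso L M) : Iso M L := h.map LieEquiv.symm

theorem Iso.trans {N : Type*} [LieRing N] [LieAlgebra ℂ N] (h : Iso L M) (h' : Iso M N) :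
    Iso L N := by
  obtain ⟨e⟩ := h
  obtain ⟨f⟩ := h'
  exact ⟨e.trans f⟩

theorem Iso.exists_bijective (h : Iso L M) : ∃ f : L →ₗ⁅ℂ⁆ M, Function.Bijective f := by
  obtain ⟨e⟩ := h
  exact ⟨e.toLieHom, e.bijective⟩

theorem Iso.tripleVanish (h : Iso L M) (hL : TripleVanish L) : TripleVanish M := by
  obtain ⟨e, hinj, hsurj⟩ := h.exists_bijective
  refine hsurj.forall₃.2 fun x y z => ?_
  rw [← LieHom.map_lie, ← LieHom.map_lie, hL, map_zero]

theorem Iso.quadVanish (h : Iso L M) (hL : QuadVanish L) : QuadVanish M := by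
  obtain ⟨e, hinj, hsurj⟩ := h.exists_bijective
  refine hsurj.forall₃.2 fun x y z => hsurj.forall.2 fun w => ?_
  rw [← LieHom.map_lie, ← LieHom.map_lie, ← LieHom.map_lie, hL, map_zero]

theorem lie_eq_zero_of_apply (e : L →ₗ⁅ℂ⁆ M) (hinj : Function.Injective e) {z : L}
    (hz : ∀ w : M, ⁅w, e z⁆ = 0) (w : L) :
    ⁅w, z⁆ = 0 :=
  hinj (by rw [LieHom.map_lie, hz, map_zero])

theorem Iso.centerBrackets (h : Iso L M) (hL : CenterBrackets L) : CenterBrackets M := by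
  obtain ⟨e, hinj, hsurj⟩ := h.exists_bijective
  refine hsurj.forall.2 fun z hz => ?_
  obtain ⟨a, b, hab⟩ := hL z (lie_eq_zero_of_apply e hinj hz)
  exact ⟨e a, e b, by rw [← LieHom.map_lie, hab]⟩

theorem Iso.centerLine (h : Iso L M) (hL : CenterLine L) : CenterLine M := by
  obtain ⟨e, hinj, hsurj⟩ := h.exists_bijective
  obtain ⟨v, hv⟩ := hL
  refine ⟨e v, hsurj.forall.2 fun z hz => ?_⟩
  obtain ⟨c, hc⟩ := hv z (lie_eq_zero_of_apply e hinj hz)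
  exact ⟨c, by rw [hc, map_smul]⟩

theorem Iso.engelElement (h : Iso L M) (hL : EngelElement L) : EngelElement M := by
  obtain ⟨e, hinj, hsurj⟩ := h.exists_bijective
  obtain ⟨x, y, h1, h2⟩ := hL
  refine ⟨e x, e y, hsurj.forall₂.2 fun a b => ?_, fun h3 => h2 (hinj ?_)⟩
  · rw [← LieHom.map_lie, ← LieHom.map_lie, h1, map_zero]
  · rw [LieHom.map_lie, LieHom.map_lie, LieHom.map_lie, h3, map_zero]

theorem Iso.derivedLine (h : Iso L M) (hL : DerivedLine L) : DerivedLine M := by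
  obtain ⟨e, hinj, hsurj⟩ := h.exists_bijective
  obtain ⟨v, hv⟩ := hL
  refine ⟨e v, hsurj.forall₂.2 fun x y => ?_⟩
  obtain ⟨c, hc⟩ := hv x y
  exact ⟨c, by rw [← LieHom.map_lie, hc, map_smul]⟩

theorem Iso.isLieAbelian (h : Iso L M) (hL : IsLieAbelian L) : IsLieAbelian M := by
  obtain ⟨e, hinj, hsurj⟩ := h.exists_bijective
  refine ⟨hsurj.forall₂.2 fun x y => ?_⟩
  rw [← LieHom.map_lie, hL.trivial, map_zero]

end Invariants

/-! ### Coordinates -/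

theorem d5_br (p q r : ℂ) : (d5 p q r).br = d5Br p q r := rfl
theorem d6_br (p q : ℂ) : (d6 p q).br = d6Br p q := rfl
theorem d9_br (p q : ℂ) : (d9 p q).br = d9Br p q := rfl
theorem d12_br (p q r : ℂ) : (d12 p q r).br = d12Br p q r := rfl
theorem d13_br (p q : ℂ) : (d13 p q).br = d13Br p q := rfl
theorem d14_br (p q : ℂ) : (d14 p q).br = d14Br p q := rfl
theorem d15_br (p q : ℂ) : (d15 p q).br = d15Br p q := rfl
theorem d19_br : d19.br = d19Br := rfl
theorem d20_br (p q r s : ℂ) : (d20 p q r s).br = d20Br p q r s := rfl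
theorem d21_br (p q r : ℂ) : (d21 p q r).br = d21Br p q r := rfl
theorem d22_br (p q : ℂ) : (d22 p q).br = d22Br p q := rfl
theorem d23_br (p q : ℂ) : (d23 p q).br = d23Br p q := rfl

/-- The bracket of each entry of the table in coordinates. The index `0` carries the
coordinate of `e₅`. -/
theorem nilpotentTable_br (i : Fin 9) (x y : Fin 5 → ℂ) :
    (nilpotentTable i).br x y =
      (![![0, x 2 * y 4 - x 4 * y 2 + (x 3 * y 0 - x 0 * y 3), x 3 * y 4 - x 4 * y 3, 0, 0],
        ![0, 0, x 3 * y 0 - x 0 * y 3, x 4 * y 0 - x 0 * y 4, 0],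
        ![0, x 3 * y 0 - x 0 * y 3, x 3 * y 4 - x 4 * y 3 + (x 1 * y 0 - x 0 * y 1),
          x 4 * y 0 - x 0 * y 4, 0],
        ![0, x 3 * y 0 - x 0 * y 3, x 3 * y 4 - x 4 * y 3, x 4 * y 0 - x 0 * y 4, 0],
        ![0, 0, x 3 * y 4 - x 4 * y 3 + (x 1 * y 0 - x 0 * y 1), 0, 0],
        ![0, x 2 * y 0 - x 0 * y 2, x 3 * y 0 - x 0 * y 3, x 4 * y 0 - x 0 * y 4, 0],
        ![0, x 2 * y 0 - x 0 * y 2, 0, x 4 * y 0 - x 0 * y 4, 0],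
        ![0, 0, 0, x 4 * y 0 - x 0 * y 4, 0],
        ![0, 0, 0, 0, 0]] : Fin 9 → Fin 5 → ℂ) i := by
  fin_cases i <;> ext k <;> fin_cases k <;>
    simp [nilpotentTable, d5_br, d5Br_apply, d12_br, d12Br_apply, d13_br, d13Br_apply, d19_br,
      d19Br_apply, d20_br, d20Br_apply, d21_br, d21Br_apply, d22_br, d22Br_apply, d23_br,
      d23Br_apply, trivialStructure]

/-! ### Nilpotency and solvability -/

theorem isNilpotent_of_lie_eq_zero {L : Type*} [LieRing L] [LieAlgebra ℂ L]
    (h : ∀ x y z u v : L, ⁅x, ⁅y, ⁅z, ⁅u, v⁆⁆⁆⁆ = 0) : LieRing.IsNilpotent L := by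
  refine (LieModule.isNilpotent_iff_exists_ucs_eq_top ℂ).2 ?_
  refine ⟨5, eq_top_iff.2 fun v _ => ?_⟩
  simp only [LieSubmodule.ucs_succ, LieSubmodule.ucs_zero, LieSubmodule.mem_normalizer,
    LieSubmodule.mem_bot]
  exact fun u z y x => by simp [h x y z u v]

/-- A criterion for solvability by a chain of subspaces, each containing the brackets of the
previous one. -/
theorem isSolvable_of_chain {L : Type*} [LieRing L] [LieAlgebra ℂ L] {n : ℕ}
    (S : ℕ → Submodule ℂ L) (h0 : S 0 = ⊤) (hn : S n = ⊥)
    (h : ∀ k, ∀ x ∈ S k, ∀ y ∈ S k, ⁅x, y⁆ ∈ S (k + 1)) : LieAlgebra.IsSolvable L := by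
  have key : ∀ k, (LieAlgebra.derivedSeries ℂ L k).toSubmodule ≤ S k := by
    intro k
    induction k with
    | zero => rw [h0]; exact le_top
    | succ k ih =>
      rw [LieAlgebra.derivedSeries_def, LieAlgebra.derivedSeriesOfIdeal_succ,
        LieSubmodule.lieIdeal_oper_eq_linear_span', Submodule.span_le]
      rintro _ ⟨x, hx, y, hy, rfl⟩
      exact h k x (ih hx) y (ih hy)
  refine LieAlgebra.IsSolvable.mk (R := ℂ) (k := n) ?_
  rw [← LieSubmodule.toSubmodule_eq_bot, eq_bot_iff, ← hn]
  exact key n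

/-! ### Values of the invariants on the table -/

theorem tripleVanish_table (i : Fin 9) :
    TripleVanish (nilpotentTable i).Alg ↔ i = 4 ∨ i = 6 ∨ i = 7 ∨ i = 8 := by
  change (∀ x y z : Fin 5 → ℂ, (nilpotentTable i).br ((nilpotentTable i).br x y) z = 0) ↔ _
  simp only [nilpotentTable_br]
  constructor
  · intro h
    have h1 := h (Pi.single 4 1) (Pi.single 0 1) (Pi.single 0 1)
    have h2 := h (Pi.single 3 1) (Pi.single 4 1) (Pi.single 4 1)
    fin_cases i <;> simp at h1 h2 ⊢
  · rintro (rfl | rfl | rfl | rfl) x y z <;> simp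

theorem quadVanish_table (i : Fin 9) :
    QuadVanish (nilpotentTable i).Alg ↔ i ≠ 2 ∧ i ≠ 5 := by
  change (∀ x y z w : Fin 5 → ℂ,
    (nilpotentTable i).br ((nilpotentTable i).br ((nilpotentTable i).br x y) z) w = 0) ↔ _
  simp only [nilpotentTable_br]
  constructor
  · intro h
    have h1 := h (Pi.single 4 1) (Pi.single 0 1) (Pi.single 0 1) (Pi.single 0 1)
    fin_cases i <;> simp at h1 ⊢
  · rintro h x y z w
    fin_cases i <;> simp at h ⊢

theorem centerBrackets_table (i : Fin 9) :
    CenterBrackets (nilpotentTable i).Alg ↔ i ≠ 1 ∧ i ≠ 7 ∧ i ≠ 8 := by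
  change (∀ z : Fin 5 → ℂ, (∀ w : Fin 5 → ℂ, (nilpotentTable i).br w z = 0) →
    ∃ a b : Fin 5 → ℂ, (nilpotentTable i).br a b = z) ↔ _
  simp only [nilpotentTable_br]
  constructor
  · intro h
    -- the vector `e₁` is central in these three algebras, and no bracket has an `e₁`-component
    have h1 := h (Pi.single 1 1)
    refine ⟨?_, ?_, ?_⟩ <;> rintro rfl <;>
    · obtain ⟨a, b, hab⟩ := h1 (by simp)
      simpa using congrFun hab 1
  · intro h z hz
    have h0 := hz (Pi.single 0 1)
    have h1 := hz (Pi.single 1 1)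
    have h2 := hz (Pi.single 2 1)
    have h3 := hz (Pi.single 3 1)
    have h4 := hz (Pi.single 4 1)
    fin_cases i <;> simp at h h0 h1 h2 h3 h4
    · refine ⟨Pi.single 3 (z 1), Pi.single 0 1, ?_⟩
      ext k; fin_cases k <;> simp [*]
    · refine ⟨Pi.single 3 (z 2), Pi.single 4 1, ?_⟩
      ext k; fin_cases k <;> simp [*]
    · refine ⟨Pi.single 3 1, ![z 1, 0, 0, 0, z 2], ?_⟩
      ext k; fin_cases k <;> simp [*]
    · refine ⟨Pi.single 3 (z 2), Pi.single 4 1, ?_⟩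
      ext k; fin_cases k <;> simp [*]
    · refine ⟨Pi.single 2 (z 1), Pi.single 0 1, ?_⟩
      ext k; fin_cases k <;> simp [*]
    · refine ⟨![0, 0, z 1, 0, z 3], Pi.single 0 1, ?_⟩
      ext k; fin_cases k <;> simp [*]

theorem not_centerLine {d : LieStructure} {i j : Fin 5} (hij : i ≠ j)
    (hi : ∀ w, d.br w (Pi.single i 1) = 0) (hj : ∀ w, d.br w (Pi.single j 1) = 0) :
    ¬ CenterLine d.Alg := by
  change ¬ ∃ v : Fin 5 → ℂ, ∀ z : Fin 5 → ℂ, (∀ w, d.br w z = 0) → ∃ c : ℂ, z = c • v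
  rintro ⟨v, hv⟩
  obtain ⟨a, ha⟩ := hv (Pi.single i 1) hi
  obtain ⟨b, hb⟩ := hv (Pi.single j 1) hj
  have h1 : (1 : ℂ) = a * v i := by simpa using congrFun ha i
  have h2 : (0 : ℂ) = a * v j := by simpa [hij, hij.symm] using congrFun ha j
  have h3 : (1 : ℂ) = b * v j := by simpa using congrFun hb j
  grind

theorem centerLine_of_forall {d : LieStructure} (i : Fin 5)
    (h : ∀ z : Fin 5 → ℂ, (∀ w, d.br w z = 0) → ∀ k, k ≠ i → z k = 0) : CenterLine d.Alg := by
  change ∃ v : Fin 5 → ℂ, ∀ z : Fin 5 → ℂ, (∀ w, d.br w z = 0) → ∃ c : ℂ, z = c • v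
  refine ⟨Pi.single i 1, fun z hz => ⟨z i, ?_⟩⟩
  ext k
  by_cases hk : k = i
  · subst hk; simp
  · simp [hk, h z hz k hk]

theorem centerLine_table (i : Fin 9) :
    CenterLine (nilpotentTable i).Alg ↔ i = 0 ∨ i = 2 ∨ i = 4 ∨ i = 5 := by
  constructor
  · contrapose!
    intro h
    have h12 : (1 : Fin 5) ≠ 2 := by decide
    have h13 : (1 : Fin 5) ≠ 3 := by decide
    fin_cases i <;> simp at h
    · exact not_centerLine h12 (by simp [nilpotentTable_br]) (by simp [nilpotentTable_br])
    · exact not_centerLine h12 (by simp [nilpotentTable_br]) (by simp [nilpotentTable_br])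
    · exact not_centerLine h13 (by simp [nilpotentTable_br]) (by simp [nilpotentTable_br])
    · exact not_centerLine h12 (by simp [nilpotentTable_br]) (by simp [nilpotentTable_br])
    · exact not_centerLine h12 (by simp [nilpotentTable_br]) (by simp [nilpotentTable_br])
  · have key : ∀ z : Fin 5 → ℂ, (∀ w, (nilpotentTable i).br w z = 0) →
        (i = 0 ∨ i = 5 → ∀ k, k ≠ 1 → z k = 0) ∧ (i = 2 ∨ i = 4 → ∀ k, k ≠ 2 → z k = 0) := by
      intro z hz
      simp only [nilpotentTable_br] at hz
      have h0 := hz (Pi.single 0 1)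
      have h1 := hz (Pi.single 1 1)
      have h2 := hz (Pi.single 2 1)
      have h3 := hz (Pi.single 3 1)
      have h4 := hz (Pi.single 4 1)
      constructor <;> rintro (rfl | rfl) k hk <;> simp at h0 h1 h2 h3 h4 <;>
        fin_cases k <;> simp_all
    rintro (rfl | rfl | rfl | rfl)
    · exact centerLine_of_forall 1 fun z hz => (key z hz).1 (by simp)
    · exact centerLine_of_forall 2 fun z hz => (key z hz).2 (by simp)
    · exact centerLine_of_forall 2 fun z hz => (key z hz).2 (by simp)
    · exact centerLine_of_forall 1 fun z hz => (key z hz).1 (by simp)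

theorem not_engelElement_table_two : ¬ EngelElement (nilpotentTable 2).Alg := by
  change ¬ ∃ x y : Fin 5 → ℂ, (∀ a b : Fin 5 → ℂ,
    (nilpotentTable 2).br x ((nilpotentTable 2).br a b) = 0) ∧
    (nilpotentTable 2).br ((nilpotentTable 2).br ((nilpotentTable 2).br x y) y) y ≠ 0
  simp only [nilpotentTable_br]
  rintro ⟨x, y, h, hne⟩
  have h1 := h (Pi.single 4 1) (Pi.single 0 1)
  simp at h1
  exact hne (by simp [h1])

theorem engelElement_table_five : EngelElement (nilpotentTable 5).Alg := by
  change ∃ x y : Fin 5 → ℂ, (∀ a b : Fin 5 → ℂ,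
    (nilpotentTable 5).br x ((nilpotentTable 5).br a b) = 0) ∧
    (nilpotentTable 5).br ((nilpotentTable 5).br ((nilpotentTable 5).br x y) y) y ≠ 0
  simp only [nilpotentTable_br]
  exact ⟨Pi.single 4 1, Pi.single 0 1, by simp, by simp⟩

theorem isLieAbelian_table (i : Fin 9) : IsLieAbelian (nilpotentTable i).Alg ↔ i = 8 := by
  constructor
  · intro h
    have h1 : (nilpotentTable i).br (Pi.single 4 1) (Pi.single 0 1) = 0 := h.trivial _ _
    have h2 : (nilpotentTable i).br (Pi.single 3 1) (Pi.single 4 1) = 0 := h.trivial _ _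
    rw [nilpotentTable_br] at h1 h2
    fin_cases i <;> simp at h1 h2 ⊢
  · rintro rfl
    exact ⟨fun _ _ => rfl⟩

theorem isNilpotent_table (i : Fin 9) : LieRing.IsNilpotent (nilpotentTable i).Alg := by
  refine isNilpotent_of_lie_eq_zero ?_
  change ∀ x y z u v : Fin 5 → ℂ, (nilpotentTable i).br x ((nilpotentTable i).br y
    ((nilpotentTable i).br z ((nilpotentTable i).br u v))) = 0
  simp only [nilpotentTable_br]
  intro x y z u v
  fin_cases i <;> simp

theorem eq_of_iso_table (i j : Fin 9) (h : Iso (nilpotentTable i).Alg (nilpotentTable j).Alg) :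
    i = j := by
  have h1 : TripleVanish (nilpotentTable i).Alg ↔ TripleVanish (nilpotentTable j).Alg :=
    ⟨h.tripleVanish, h.symm.tripleVanish⟩
  have h2 : QuadVanish (nilpotentTable i).Alg ↔ QuadVanish (nilpotentTable j).Alg :=
    ⟨h.quadVanish, h.symm.quadVanish⟩
  have h3 : CenterBrackets (nilpotentTable i).Alg ↔ CenterBrackets (nilpotentTable j).Alg :=
    ⟨h.centerBrackets, h.symm.centerBrackets⟩
  have h4 : CenterLine (nilpotentTable i).Alg ↔ CenterLine (nilpotentTable j).Alg :=
    ⟨h.centerLine, h.symm.centerLine⟩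
  have h5 : IsLieAbelian (nilpotentTable i).Alg ↔ IsLieAbelian (nilpotentTable j).Alg :=
    ⟨h.isLieAbelian, h.symm.isLieAbelian⟩
  have h6 : ¬ (i = 2 ∧ j = 5) := by
    rintro ⟨rfl, rfl⟩
    exact not_engelElement_table_two (h.symm.engelElement engelElement_table_five)
  have h7 : ¬ (i = 5 ∧ j = 2) := by
    rintro ⟨rfl, rfl⟩
    exact not_engelElement_table_two (h.engelElement engelElement_table_five)
  rw [tripleVanish_table, tripleVanish_table] at h1
  rw [quadVanish_table, quadVanish_table] at h2
  rw [centerBrackets_table, centerBrackets_table] at h3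
  rw [centerLine_table, centerLine_table] at h4
  rw [isLieAbelian_table, isLieAbelian_table] at h5
  clear h
  grind

/-! ### Solvability of the families -/

/-- One chain serves all families: the subspaces `x₅ = 0`, then `x₅ = x₄ = 0`, then
`x₅ = x₄ = x₃ = 0`. -/
theorem isSolvable_alg (d : LieStructure) (h1 : ∀ x y : Fin 5 → ℂ, d.br x y 0 = 0)
    (h2 : ∀ x y : Fin 5 → ℂ, x 0 = 0 → y 0 = 0 → d.br x y 4 = 0)
    (h3 : ∀ x y : Fin 5 → ℂ, x 0 = 0 → x 4 = 0 → y 0 = 0 → y 4 = 0 → d.br x y 3 = 0)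
    (h4 : ∀ x y : Fin 5 → ℂ, x 0 = 0 → x 4 = 0 → x 3 = 0 → y 0 = 0 → y 4 = 0 → y 3 = 0 →
      d.br x y = 0) : LieAlgebra.IsSolvable d.Alg := by
  let K (i : Fin 5) : Submodule ℂ (Fin 5 → ℂ) := LinearMap.ker (LinearMap.proj i)
  let S : ℕ → Submodule ℂ (Fin 5 → ℂ)
    | 0 => ⊤
    | 1 => K 0
    | 2 => K 0 ⊓ K 4
    | 3 => K 0 ⊓ K 4 ⊓ K 3
    | _ + 4 => ⊥
  have hS : ∀ k, ∀ x ∈ S k, ∀ y ∈ S k, d.br x y ∈ S (k + 1) := by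
    rintro (_ | _ | _ | _ | k) x hx y hy
    · exact h1 x y
    · exact ⟨h1 x y, h2 x y hx hy⟩
    · exact ⟨⟨h1 x y, h2 x y hx.1 hy.1⟩, h3 x y hx.1 hx.2 hy.1 hy.2⟩
    · exact h4 x y hx.1.1 hx.1.2 hx.2 hy.1.1 hy.1.2 hy.2
    · rw [(Submodule.mem_bot ℂ).1 hx, map_zero]
      exact Submodule.zero_mem _
  exact isSolvable_of_chain (L := d.Alg) (n := 4) S rfl rfl hS

theorem isSolvable_member (F : Family) (a : Fin F.arity → ℂ) :
    LieAlgebra.IsSolvable (F.member a).Alg := by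
  cases F <;> simp only [Family.member] <;> apply isSolvable_alg <;>
    simp +contextual [d5_br, d5Br_apply, d6_br, d6Br_apply, d9_br, d9Br_apply, d12_br,
      d12Br_apply, d13_br, d13Br_apply, d14_br, d14Br_apply, d15_br, d15Br_apply, d20_br,
      d20Br_apply, d21_br, d21Br_apply, d22_br, d22Br_apply, d23_br, d23Br_apply]

/-! ### The Heisenberg algebra and the families -/

theorem derivedLine_d19 : DerivedLine d19.Alg := by
  change ∃ v : Fin 5 → ℂ, ∀ x y : Fin 5 → ℂ, ∃ c : ℂ, d19Br x y = c • v
  refine ⟨Pi.single 2 1, fun x y => ⟨d19Br x y 2, ?_⟩⟩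
  ext k
  fin_cases k <;> simp [d19Br_apply]

/-- If the derived algebra is a line, then the `2 × 2` minors formed from the coordinates of two
brackets vanish. -/
theorem DerivedLine.minor_eq_zero {d : LieStructure} (h : DerivedLine d.Alg)
    (x y u v : Fin 5 → ℂ) (i j : Fin 5) :
    d.br x y i * d.br u v j - d.br x y j * d.br u v i = 0 := by
  have h' : ∃ w : Fin 5 → ℂ, ∀ x y : Fin 5 → ℂ, ∃ c : ℂ, d.br x y = c • w := h
  obtain ⟨w, hw⟩ := h'
  obtain ⟨a, ha⟩ := hw x y
  obtain ⟨b, hb⟩ := hw u v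
  rw [ha, hb]
  simp only [Pi.smul_apply, smul_eq_mul]
  ring

theorem not_iso_d19_member (F : Family) (a : Fin F.arity → ℂ) :
    ¬ Iso d19.Alg (F.member a).Alg := by
  intro h
  have hD := h.derivedLine derivedLine_d19
  have hC : CenterLine (F.member a).Alg := h.centerLine ((centerLine_table 4).2 (by simp))
  have m1 := hD.minor_eq_zero (Pi.single 2 1) (Pi.single 4 1) (Pi.single 3 1) (Pi.single 4 1) 1 2
  have m2 := hD.minor_eq_zero (Pi.single 2 1) (Pi.single 3 1) (Pi.single 3 1) (Pi.single 4 1) 1 2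
  have m3 := hD.minor_eq_zero (Pi.single 4 1) (Pi.single 0 1) (Pi.single 3 1) (Pi.single 4 1) 2 3
  have m4 := hD.minor_eq_zero (Pi.single 3 1) (Pi.single 0 1) (Pi.single 3 1) (Pi.single 4 1) 1 2
  have m5 := hD.minor_eq_zero (Pi.single 2 1) (Pi.single 0 1) (Pi.single 3 1) (Pi.single 0 1) 1 2
  have m6 := hD.minor_eq_zero (Pi.single 3 1) (Pi.single 0 1) (Pi.single 4 1) (Pi.single 0 1) 2 3
  have m7 := hD.minor_eq_zero (Pi.single 2 1) (Pi.single 0 1) (Pi.single 4 1) (Pi.single 0 1) 1 3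
  have m8 := hD.minor_eq_zero (Pi.single 1 1) (Pi.single 0 1) (Pi.single 2 1) (Pi.single 0 1) 1 2
  cases F <;> simp only [Family.member] at m1 m2 m3 m4 m5 m6 m7 m8 hC
  · simp [d5_br, d5Br_apply] at m1
  · simp [d6_br, d6Br_apply] at m1
  · simp [d9_br, d9Br_apply] at m2
  · simp [d12_br, d12Br_apply] at m3
  · simp [d13_br, d13Br_apply] at m3
  · simp [d14_br, d14Br_apply] at m4
  · simp [d15_br, d15Br_apply] at m4
  · simp [d20_br, d20Br_apply] at m5
  · simp [d21_br, d21Br_apply] at m6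
  · simp [d22_br, d22Br_apply] at m7
  · -- here `p = 0`, and the center contains `e₁` and `e₂`
    simp only [d23_br, d23Br_apply] at m8
    simp at m8
    have hC' : CenterLine (d23 (a (0 : Fin 2)) (a (1 : Fin 2))).Alg := hC
    rw [m8] at hC'
    refine not_centerLine (i := 1) (j := 2) (by decide) ?_ ?_ hC' <;> simp [d23_br, d23Br_apply]

/-! ### Decomposability -/

section Decomposable

variable {L : Type*} [LieRing L] [LieAlgebra ℂ L]

/-- Bracketing a linear relation with `y` and with `x` kills its coefficients one by one. -/
theorem linearIndependent_of_lie_ne_zero {x y z : L} (hxy : ⁅x, y⁆ ≠ 0) (hz : ∀ w : L, ⁅w, z⁆ = 0)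
    (hz0 : z ≠ 0) : LinearIndependent ℂ ![x, y, z] := by
  have hz' : ∀ w : L, ⁅z, w⁆ = 0 := fun w => by rw [← lie_skew, hz, neg_zero]
  rw [Fintype.linearIndependent_iff]
  intro g hg
  simp only [Fin.sum_univ_three, Matrix.cons_val] at hg
  have h0 : g 0 = 0 := by
    have := congrArg (fun w => ⁅w, y⁆) hg
    simpa [hz', hxy] using this
  have h1 : g 1 = 0 := by
    have := congrArg (fun w => ⁅x, w⁆) hg
    simpa [hz, hxy] using this
  have h2 : g 2 = 0 := by simpa [h0, h1, hz0] using hg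
  intro i
  fin_cases i <;> assumption

/-- A nilpotent Lie algebra of dimension at most two is abelian: two noncommuting elements and a
nonzero central one would be linearly independent. -/
theorem isLieAbelian_of_finrank_le_two [FiniteDimensional ℂ L] (hL : LieRing.IsNilpotent L)
    (h : Module.finrank ℂ L ≤ 2) : IsLieAbelian L := by
  refine ⟨fun x y => by_contra fun hxy => ?_⟩
  have : Nontrivial L := ⟨⁅x, y⁆, 0, hxy⟩
  have := LieModule.nontrivial_max_triv_of_isNilpotent ℂ L L
  obtain ⟨⟨z, hz⟩, hz0⟩ := exists_ne (0 : LieModule.maxTrivSubmodule ℂ L L)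
  have hli := linearIndependent_of_lie_ne_zero hxy
    ((LieModule.mem_maxTrivSubmodule ℂ L L z).1 hz) (fun h0 => hz0 (Subtype.ext h0))
  have := hli.fintype_card_le_finrank
  simp at this
  omega

/-- In a five-dimensional decomposable algebra one of the two summands has dimension at most two;
if the algebra is nilpotent, that summand is abelian, hence central, and it meets the derived
algebra trivially. -/
theorem CenterBrackets.not_isDecomposable (hC : CenterBrackets L) (hL : LieRing.IsNilpotent L)
    (h5 : Module.finrank ℂ L = 5) : ¬ IsDecomposable L := by
  have : FiniteDimensional ℂ L := Module.finite_of_finrank_eq_succ h5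
  suffices key : ∀ I J : LieIdeal ℂ L, IsCompl I J → Module.finrank ℂ J ≤ 2 → J = ⊥ by
    rintro ⟨I, J, hI, hJ, hIJ⟩
    have hsum := Submodule.finrank_add_eq_of_isCompl (LieSubmodule.isCompl_toSubmodule.2 hIJ)
    change Module.finrank ℂ I + Module.finrank ℂ J = _ at hsum
    rcases le_or_gt (Module.finrank ℂ J) 2 with h | h
    · exact hJ (key I J hIJ h)
    · exact hI (key J I hIJ.symm (by omega))
  intro I J hIJ h2
  have hnil : LieRing.IsNilpotent J :=
    Function.Injective.lieAlgebra_isNilpotent (f := J.incl) J.incl_injective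
  have hab := isLieAbelian_of_finrank_le_two hnil h2
  have hJJ : ∀ x ∈ J, ∀ y ∈ J, ⁅x, y⁆ = 0 := fun x hx y hy =>
    congrArg Subtype.val (hab.trivial ⟨x, hx⟩ ⟨y, hy⟩)
  have hIJ0 : ∀ x ∈ I, x ∈ J → x = 0 := fun x hx hx' =>
    (LieSubmodule.mem_bot x).1 (hIJ.inf_eq_bot ▸ (LieSubmodule.mem_inf _ _ _).2 ⟨hx, hx'⟩)
  have hdec : ∀ w : L, ∃ i ∈ I, ∃ j ∈ J, i + j = w := fun w =>
    (LieSubmodule.mem_sup I J w).1 (hIJ.sup_eq_top ▸ LieSubmodule.mem_top w)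
  have hJZ : ∀ z ∈ J, ∀ w : L, ⁅w, z⁆ = 0 := by
    intro z hz w
    obtain ⟨i, hi, j, hj, rfl⟩ := hdec w
    rw [add_lie, hJJ j hj z hz, add_zero]
    exact hIJ0 _ (lie_mem_left ℂ L I i z hi) (lie_mem_right ℂ L J i z hz)
  rw [eq_bot_iff]
  intro z hz
  obtain ⟨a, b, rfl⟩ := hC z (hJZ z hz)
  obtain ⟨i, hi, j, hj, rfl⟩ := hdec a
  refine (LieSubmodule.mem_bot _).2 (hIJ0 _ ?_ hz)
  rw [add_lie, ← lie_skew j b, hJZ j hj, neg_zero, add_zero]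
  exact lie_mem_left ℂ L I i b hi

/-- A central element `e` splits off as a direct summand if some functional `φ` with
`φ e = 1` vanishes on all brackets and is not injective. -/
theorem isDecomposable_of_functional (φ : L →ₗ[ℂ] ℂ) {e u : L} (he : ∀ w : L, ⁅w, e⁆ = 0)
    (hφe : φ e = 1) (hφ : ∀ x y : L, φ ⁅x, y⁆ = 0) (hu : u ≠ 0) (hφu : φ u = 0) :
    IsDecomposable L := by
  let I : LieIdeal ℂ L :=
    { Submodule.span ℂ {e} with
      lie_mem := by
        intro x m hm
        obtain ⟨c, rfl⟩ := Submodule.mem_span_singleton.1 hm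
        rw [lie_smul, he, smul_zero]
        exact Submodule.zero_mem _ }
  let J : LieIdeal ℂ L :=
    { LinearMap.ker φ with
      lie_mem := fun {x m} _ => hφ x m }
  have hI : ∀ x, x ∈ I ↔ ∃ c : ℂ, c • e = x := fun x => Submodule.mem_span_singleton
  have hJ : ∀ x, x ∈ J ↔ φ x = 0 := fun x => LinearMap.mem_ker
  refine ⟨I, J, fun h => ?_, fun h => ?_, ?_⟩
  · have : e ∈ I := (hI e).2 ⟨1, one_smul _ _⟩
    rw [h, LieSubmodule.mem_bot] at this
    simp [this] at hφe
  · have : u ∈ J := (hJ u).2 hφu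
    rw [h, LieSubmodule.mem_bot] at this
    exact hu this
  · refine ⟨disjoint_iff.2 ?_, codisjoint_iff.2 ?_⟩
    · rw [eq_bot_iff]
      intro x hx
      obtain ⟨hxI, hxJ⟩ := (LieSubmodule.mem_inf _ _ _).1 hx
      obtain ⟨c, rfl⟩ := (hI x).1 hxI
      have : c = 0 := by simpa [hφe] using (hJ _).1 hxJ
      simp [this]
    · rw [eq_top_iff]
      intro x _
      exact (LieSubmodule.mem_sup I J x).2 ⟨φ x • e, (hI _).2 ⟨_, rfl⟩, x - φ x • e,
        (hJ _).2 (by simp [hφe]), by abel⟩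

end Decomposable

theorem finrank_alg (d : LieStructure) : Module.finrank ℂ d.Alg = 5 :=
  Module.finrank_fin_fun ℂ

/-- If `e₁` is central and no bracket has an `e₁`-component, the line through `e₁` is a direct
summand. -/
theorem isDecomposable_of_split (d : LieStructure) (h1 : ∀ w, d.br w (Pi.single 1 1) = 0)
    (h2 : ∀ x y, d.br x y 1 = 0) : IsDecomposable d.Alg := by
  let φ : (Fin 5 → ℂ) →ₗ[ℂ] ℂ := LinearMap.proj 1
  have hu : (Pi.single 2 1 : Fin 5 → ℂ) ≠ 0 := by simp
  have hφe : φ (Pi.single 1 1) = 1 := by simp [φ]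
  have hφu : φ (Pi.single 2 1) = 0 := by simp [φ]
  exact isDecomposable_of_functional (L := d.Alg) φ h1 hφe h2 hu hφu

theorem isDecomposable_table (i : Fin 9) :
    IsDecomposable (nilpotentTable i).Alg ↔ i = 1 ∨ i = 7 ∨ i = 8 := by
  constructor
  · contrapose!
    intro h
    exact ((centerBrackets_table i).2 h).not_isDecomposable (isNilpotent_table i) (finrank_alg _)
  · intro h
    refine isDecomposable_of_split _ ?_ ?_ <;> simp only [nilpotentTable_br] <;>
      rcases h with rfl | rfl | rfl <;> simp

/-! ### Recognizing an algebra from a basis -/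

/-- A five-dimensional Lie algebra spanned by five vectors whose brackets are those of the standard
basis under `d` is isomorphic to the algebra of `d`. -/
theorem iso_of_span {L : Type*} [LieRing L] [LieAlgebra ℂ L] (d : LieStructure)
    (h5 : Module.finrank ℂ L = 5) (v : Fin 5 → L) (hv : ⊤ ≤ Submodule.span ℂ (Set.range v))
    (hbr : ∀ i j, i < j →
      ⁅v i, v j⁆ = ∑ k, d.br (Pi.single i 1) (Pi.single j 1) k • v k) : Iso L d.Alg := by
  let b := basisOfTopLeSpanOfCardEqFinrank v hv (by simp [h5])
  have hb : ∀ i, b i = v i := fun i => by simp [b]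
  have hbr' : ∀ i j, ⁅v i, v j⁆ = ∑ k, d.br (Pi.single i 1) (Pi.single j 1) k • v k := by
    intro i j
    rcases lt_trichotomy i j with h | rfl | h
    · exact hbr i j h
    · simp [d.br_self]
    · have hskew : d.br (Pi.single i 1) (Pi.single j 1) = -d.br (Pi.single j 1) (Pi.single i 1) :=
        (lie_skew (L := d.Alg) (Pi.single i 1 : Fin 5 → ℂ) (Pi.single j 1 : Fin 5 → ℂ)).symm
      rw [← lie_skew, hbr j i h, hskew]
      simp
  let e : L ≃ₗ[ℂ] (Fin 5 → ℂ) := b.equivFun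
  have he : ∀ i, e (v i) = Pi.single i 1 := by
    intro i
    ext j
    rw [← hb i, Module.Basis.equivFun_self]
    simp [Pi.single_apply, eq_comm]
  have hbil : LinearMap.compr₂ (LieModule.toEnd ℂ L L : L →ₗ[ℂ] L →ₗ[ℂ] L) e.toLinearMap
      = d.br.compl₁₂ e.toLinearMap e.toLinearMap := by
    refine LinearMap.ext_basis b b fun i j => ?_
    simp only [hb, LinearMap.compr₂_apply, LinearMap.compl₁₂_apply, LinearEquiv.coe_coe, he]
    change e ⁅v i, v j⁆ = _
    rw [hbr', map_sum]
    ext k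
    simp [he, Pi.single_apply]
  have key : ∀ x y, e ⁅x, y⁆ = d.br (e x) (e y) := fun x y =>
    LinearMap.congr_fun (LinearMap.congr_fun hbil x) y
  exact ⟨{ e with map_lie' := fun {x y} => key x y }⟩

/-! ### Coincidences between generic elements -/

/-- The recognition criterion for algebras on `ℂ⁵`, in coordinates. -/
theorem iso_alg_of_span (d d' : LieStructure) (v : Fin 5 → Fin 5 → ℂ)
    (hv : ∀ x, ∃ c : Fin 5 → ℂ, ∑ i, c i • v i = x)
    (hbr : ∀ i j, i < j →
      d.br (v i) (v j) = ∑ k, d'.br (Pi.single i 1) (Pi.single j 1) k • v k) :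
    Iso d.Alg d'.Alg :=
  iso_of_span (L := d.Alg) d' (finrank_alg d) v
    (fun x _ => (Submodule.mem_span_range_iff_exists_fun ℂ).2 (hv x)) hbr

/-- In `d₁₄(0:0)` the vector `e₃ + e₅` commutes with `e₁ + e₄`, as `e₃` does with `e₂` in
`d₅(0:0:0)`. -/
theorem iso_d14_d5 : Iso (d14 0 0).Alg (d5 0 0 0).Alg := by
  refine iso_alg_of_span _ _
    ![![0, 0, 0, 0, 1], ![0, 0, 1, 0, 0], ![0, 1, 0, 0, 1], ![1, 0, 0, 1, 0], ![1, 0, 0, 0, 0]]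
    (fun x => ⟨![x 4 - x 1, x 2, x 1, x 3, x 0 - x 3], ?_⟩) ?_
  · ext k
    fin_cases k <;> simp [Fin.sum_univ_five]
  · intro i j hij
    fin_cases i <;> fin_cases j <;> simp at hij <;> ext k <;> fin_cases k <;>
      simp [Fin.sum_univ_five, d14_br, d14Br_apply, d5_br, d5Br_apply]

theorem iso_d14_d15 : Iso (d14 0 0).Alg (d15 0 0).Alg := by
  refine iso_alg_of_span _ _
    ![![1, 0, 0, 0, 0], ![0, 1, 0, 0, 1], ![0, 0, 1, 0, 0], ![1, 0, 0, 1, 0], ![0, 0, 0, 0, 1]]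
    (fun x => ⟨![x 0 - x 3, x 1, x 2, x 3, x 4 - x 1], ?_⟩) ?_
  · ext k
    fin_cases k <;> simp [Fin.sum_univ_five]
  · intro i j hij
    fin_cases i <;> fin_cases j <;> simp at hij <;> ext k <;> fin_cases k <;>
      simp [Fin.sum_univ_five, d14_br, d14Br_apply, d15_br, d15Br_apply]

/-- The element `e₅ - e₄` of `d₆(0:0)` is central and spans a direct summand. -/
theorem iso_d6_d21 : Iso (d6 0 0).Alg (d21 0 0 0).Alg := by
  refine iso_alg_of_span _ _
    ![![0, 0, 0, 0, 1], ![1, 0, 0, 0, -1], ![0, 1, 0, 0, 0], ![0, 0, 1, 0, 0], ![0, 0, 0, 1, 0]]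
    (fun x => ⟨![x 4 + x 0, x 0, x 1, x 2, x 3], ?_⟩) ?_
  · ext k
    fin_cases k <;> simp [Fin.sum_univ_five]
  · intro i j hij
    fin_cases i <;> fin_cases j <;> simp at hij <;> ext k <;> fin_cases k <;>
      simp [Fin.sum_univ_five, d6_br, d6Br_apply, d21_br, d21Br_apply]

theorem iso_d9_d12 : Iso (d9 0 0).Alg (d12 0 0 0).Alg := by
  refine iso_alg_of_span _ _
    ![![0, 0, 0, 1, 0], ![0, 0, -1, 0, 0], ![0, -1, 0, 0, 0], ![0, 0, 0, 0, 1], ![-1, 0, 0, 0, 0]]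
    (fun x => ⟨![x 3, -x 2, -x 1, x 4, -x 0], ?_⟩) ?_
  · ext k
    fin_cases k <;> simp [Fin.sum_univ_five]
  · intro i j hij
    fin_cases i <;> fin_cases j <;> simp at hij <;> ext k <;> fin_cases k <;>
      simp [Fin.sum_univ_five, d9_br, d9Br_apply, d12_br, d12Br_apply]

/-- The generic elements are, up to isomorphism, the entries of the table other than `d₁₉` and the
abelian algebra. -/
theorem exists_iso_generic_iff_table {L : Type*} [LieRing L] [LieAlgebra ℂ L] :
    (∃ F : Family, Iso L F.generic.Alg) ↔
      ∃ i : Fin 9, i ≠ 4 ∧ i ≠ 8 ∧ Iso L (nilpotentTable i).Alg := by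
  constructor
  · rintro ⟨F, h⟩
    cases F
    · exact ⟨0, by decide, by decide, h⟩
    · exact ⟨1, by decide, by decide, h.trans iso_d6_d21⟩
    · exact ⟨2, by decide, by decide, h.trans iso_d9_d12⟩
    · exact ⟨2, by decide, by decide, h⟩
    · exact ⟨3, by decide, by decide, h⟩
    · exact ⟨0, by decide, by decide, h.trans iso_d14_d5⟩
    · exact ⟨0, by decide, by decide, h.trans (iso_d14_d15.symm.trans iso_d14_d5)⟩
    · exact ⟨5, by decide, by decide, h⟩
    · exact ⟨1, by decide, by decide, h⟩
    · exact ⟨6, by decide, by decide, h⟩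
    · exact ⟨7, by decide, by decide, h⟩
  · rintro ⟨i, h4, h8, h⟩
    fin_cases i
    · exact ⟨.f5, h⟩
    · exact ⟨.f21, h⟩
    · exact ⟨.f12, h⟩
    · exact ⟨.f13, h⟩
    · exact absurd rfl h4
    · exact ⟨.f20, h⟩
    · exact ⟨.f22, h⟩
    · exact ⟨.f23, h⟩
    · exact absurd rfl h8

theorem Iso.isNilpotent {L M : Type*} [LieRing L] [LieAlgebra ℂ L] [LieRing M] [LieAlgebra ℂ M]
    (h : Iso L M) (hM : LieRing.IsNilpotent M) : LieRing.IsNilpotent L := by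
  obtain ⟨e⟩ := h
  exact (LieEquiv.nilpotent_iff_equiv_nilpotent e).2 hM

theorem isNilpotent_generic (F : Family) : LieRing.IsNilpotent F.generic.Alg := by
  obtain ⟨i, -, -, h⟩ := exists_iso_generic_iff_table.1 ⟨F, ⟨LieEquiv.refl⟩⟩
  exact h.isNilpotent (isNilpotent_table i)

/-! ### Generators of the lower central series -/

theorem lie_flip {L : Type*} [LieRing L] {x y z : L} (h : ⁅x, y⁆ = z) : ⁅y, x⁆ = -z := by
  rw [← lie_skew, h]

section Generators

variable {L : Type*} [LieRing L] [LieAlgebra ℂ L]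

variable (L) in
/-- The `k`-th term of the lower central series as a subspace, with `lcs L 0 = ⊤`. -/
abbrev lcs (k : ℕ) : Submodule ℂ L := (LieModule.lowerCentralSeries ℂ L L k).toSubmodule

/-- The set `R` spans the `k`-th term of the lower central series modulo the next term. -/
def SpansModNext (k : ℕ) (R : Set L) : Prop := lcs L k ≤ lcs L (k + 1) ⊔ Submodule.span ℂ R

theorem lie_mem_lcs_succ {k : ℕ} {y : L} (x : L) (hy : y ∈ lcs L k) : ⁅x, y⁆ ∈ lcs L (k + 1) := by
  change ⁅x, y⁆ ∈ LieModule.lowerCentralSeries ℂ L L (k + 1)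
  rw [LieModule.lowerCentralSeries_succ]
  exact LieSubmodule.lie_mem_lie (LieSubmodule.mem_top x) hy

theorem lie_mem_lcs_one (x y : L) : ⁅x, y⁆ ∈ lcs L 1 :=
  lie_mem_lcs_succ x (by simp)

theorem lcs_succ_le {k : ℕ} {T : Submodule ℂ L} (h : ∀ x : L, ∀ y ∈ lcs L k, ⁅x, y⁆ ∈ T) :
    lcs L (k + 1) ≤ T := by
  rw [lcs, LieModule.lowerCentralSeries_succ, LieSubmodule.lieIdeal_oper_eq_linear_span',
    Submodule.span_le]
  rintro _ ⟨x, -, y, hy, rfl⟩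
  exact h x y hy

theorem lcs_antitone : Antitone (lcs L) := fun _ _ h =>
  LieModule.antitone_lowerCentralSeries ℂ L L h

/-- The Jacobi identity: brackets with the derived algebra descend by two terms. -/
theorem lie_mem_lcs_add_two {k : ℕ} {x y : L} (hx : x ∈ lcs L 1) (hy : y ∈ lcs L k) :
    ⁅x, y⁆ ∈ lcs L (k + 2) := by
  let T : Submodule ℂ L := (lcs L (k + 2)).comap
    ((LieModule.toEnd ℂ L L : L →ₗ[ℂ] L →ₗ[ℂ] L).flip y)
  have hT : lcs L 1 ≤ T := by
    refine lcs_succ_le fun u v _ => ?_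
    change ⁅⁅u, v⁆, y⁆ ∈ lcs L (k + 2)
    rw [lie_lie]
    exact sub_mem (lie_mem_lcs_succ u (lie_mem_lcs_succ v hy))
      (lie_mem_lcs_succ v (lie_mem_lcs_succ u hy))
  exact hT hx

/-- The lower central series of a nilpotent algebra cannot become stationary before it
vanishes. -/
theorem lcs_eq_bot_of_le_succ (hL : LieRing.IsNilpotent L) {k : ℕ}
    (h : lcs L k ≤ lcs L (k + 1)) : lcs L k = ⊥ := by
  have hstep : ∀ n, lcs L k ≤ lcs L (k + n) := by
    intro n
    induction n with
    | zero => exact le_rfl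
    | succ n ih =>
      exact h.trans (lcs_succ_le fun x y hy => lie_mem_lcs_succ x (ih hy))
  obtain ⟨m, hm⟩ := (LieModule.isNilpotent_iff ℂ L L).1 hL
  have hle := (hstep m).trans (lcs_antitone (Nat.le_add_left m k))
  rw [lcs, lcs, hm] at hle
  exact le_bot_iff.1 hle

theorem finrank_lcs_succ_lt [FiniteDimensional ℂ L] (hL : LieRing.IsNilpotent L) {k : ℕ}
    (h : Module.finrank ℂ (lcs L k) ≠ 0) :
    Module.finrank ℂ (lcs L (k + 1)) < Module.finrank ℂ (lcs L k) := by
  refine Submodule.finrank_lt_finrank_of_lt (lt_of_le_not_ge (lcs_antitone k.le_succ) fun hle => ?_)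
  rw [lcs_eq_bot_of_le_succ hL hle] at h
  simp at h

/-- Brackets of generators span the next term of the lower central series modulo the one after. -/
theorem SpansModNext.succ {k : ℕ} {S R : Set L} (hS : SpansModNext 0 S) (hR : SpansModNext k R) :
    SpansModNext (k + 1) (Set.image2 (fun s r => ⁅s, r⁆) S R) := by
  refine lcs_succ_le fun x y hy => ?_
  obtain ⟨d, hd, s, hs, rfl⟩ := Submodule.mem_sup.1 (hS (show x ∈ lcs L 0 by simp))
  obtain ⟨d', hd', r, hr, rfl⟩ := Submodule.mem_sup.1 (hR hy)
  rw [add_lie, lie_add s]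
  refine add_mem ?_ (add_mem ?_ ?_)
  · exact Submodule.mem_sup_left (lie_mem_lcs_add_two hd hy)
  · exact Submodule.mem_sup_left (lie_mem_lcs_succ s hd')
  · refine Submodule.mem_sup_right ?_
    have h := Submodule.apply_mem_map₂ (LieModule.toEnd ℂ L L : L →ₗ[ℂ] L →ₗ[ℂ] L) hs hr
    rw [Submodule.map₂_span_span] at h
    exact h

theorem SpansModNext.le {k : ℕ} {R : Set L} (h : SpansModNext k R) {T : Submodule ℂ L}
    (hT : lcs L (k + 1) ≤ T) (hR : R ⊆ T) : lcs L k ≤ T :=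
  h.trans (sup_le hT (Submodule.span_le.2 hR))

theorem SpansModNext.of_subset {k : ℕ} {R R' : Set L} (h : SpansModNext k R)
    (hR : R ⊆ (lcs L (k + 1) ⊔ Submodule.span ℂ R' : Submodule ℂ L)) : SpansModNext k R' :=
  h.le le_sup_left hR

/-- A subspace of codimension at most `n` becomes the whole by adjoining `n` vectors. -/
theorem exists_le_sup_span [FiniteDimensional ℂ L] (n : ℕ) {M N : Submodule ℂ L} (hMN : M ≤ N)
    (h : Module.finrank ℂ N ≤ Module.finrank ℂ M + n) :
    ∃ g : Fin n → L, (∀ i, g i ∈ N) ∧ N ≤ M ⊔ Submodule.span ℂ (Set.range g) := by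
  induction n generalizing M with
  | zero => exact ⟨0, fun i => i.elim0, (Submodule.eq_of_le_of_finrank_le hMN h).ge.trans le_sup_left⟩
  | succ n ih =>
    by_cases hNM : N ≤ M
    · exact ⟨0, fun i => N.zero_mem, hNM.trans le_sup_left⟩
    · obtain ⟨x, hxN, hxM⟩ := SetLike.not_le_iff_exists.1 hNM
      have hlt : M < M ⊔ Submodule.span ℂ {x} :=
        lt_of_le_not_ge le_sup_left fun hle =>
          hxM (hle (Submodule.mem_sup_right (Submodule.mem_span_singleton_self x)))
      have hx : Submodule.span ℂ {x} ≤ N := (Submodule.span_singleton_le_iff_mem x N).2 hxN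
      obtain ⟨g, hg, hgN⟩ := ih (sup_le hMN hx)
        (by have := Submodule.finrank_lt_finrank_of_lt hlt; omega)
      refine ⟨Fin.cons x g, Fin.cases hxN hg, hgN.trans ?_⟩
      rw [Fin.range_cons, Submodule.span_insert, sup_assoc]

theorem le_span_singleton_of_finrank_eq_one [FiniteDimensional ℂ L] {N : Submodule ℂ L} {z : L}
    (hN : Module.finrank ℂ N = 1) (hz : z ∈ N) (hz0 : z ≠ 0) : N ≤ Submodule.span ℂ {z} := by
  refine (Submodule.eq_of_le_of_finrank_le ((Submodule.span_singleton_le_iff_mem z N).2 hz) ?_).ge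
  rw [hN, finrank_span_singleton hz0]

theorem lie_eq_zero_of_mem {k : ℕ} (h : lcs L (k + 1) = ⊥) {z : L} (hz : z ∈ lcs L k) (x : L) :
    ⁅x, z⁆ = 0 := by
  have := lie_mem_lcs_succ x hz
  rwa [h, Submodule.mem_bot] at this

theorem lie_eq_zero_of_mem' {k : ℕ} (h : lcs L (k + 1) = ⊥) {z : L} (hz : z ∈ lcs L k) (x : L) :
    ⁅z, x⁆ = 0 := by
  rw [← lie_skew, lie_eq_zero_of_mem h hz, neg_zero]

/-- A statement about the pairs `i < j` in `Fin 5` amounts to ten cases. -/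
theorem forall_lt_fin_five {P : Fin 5 → Fin 5 → Prop} (h01 : P 0 1) (h02 : P 0 2) (h03 : P 0 3)
    (h04 : P 0 4) (h12 : P 1 2) (h13 : P 1 3) (h14 : P 1 4) (h23 : P 2 3) (h24 : P 2 4)
    (h34 : P 3 4) : ∀ i j, i < j → P i j := by
  intro i j hij
  fin_cases i <;> fin_cases j <;> first | assumption | exact absurd hij (by decide)

/-- Spanning families stay spanning after a permutation and a rescaling by nonzero factors. -/
theorem top_le_span_of_smul {ι : Type*} {v w : ι → L}
    (hv : ⊤ ≤ Submodule.span ℂ (Set.range v)) (σ : ι → ι) (s : ι → ℂ)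
    (h : ∀ k, v k = s k • w (σ k)) : ⊤ ≤ Submodule.span ℂ (Set.range w) := by
  refine hv.trans (Submodule.span_le.2 ?_)
  rintro _ ⟨k, rfl⟩
  rw [h k]
  exact Submodule.smul_mem _ _ (Submodule.subset_span (Set.mem_range_self _))

end Generators

section Classification

variable {L : Type*} [LieRing L] [LieAlgebra ℂ L]

/-! ### Derived algebra of dimension three -/

/-- Two generators give the derived algebra a single generator modulo the next term. -/
theorem SpansModNext.pair_one {a b : L} (h : SpansModNext 0 {a, b}) : SpansModNext 1 {⁅a, b⁆} := by
  refine (h.succ h).of_subset ?_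
  rintro _ ⟨x, (rfl | rfl), y, (rfl | rfl), rfl⟩
  · simp
  · exact Submodule.mem_sup_right (Submodule.mem_span_singleton_self _)
  · exact Submodule.mem_sup_right (Submodule.mem_span_singleton.2 ⟨-1, by simp⟩)
  · simp

theorem SpansModNext.pair_two {a b : L} (h : SpansModNext 0 {a, b}) :
    SpansModNext 2 {⁅a, ⁅a, b⁆⁆, ⁅b, ⁅a, b⁆⁆} := by
  refine (h.succ h.pair_one).of_subset ?_
  rintro _ ⟨x, (rfl | rfl), y, rfl, rfl⟩ <;>
    exact Submodule.mem_sup_right (Submodule.subset_span (by simp))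

theorem SpansModNext.finrank_le_succ [FiniteDimensional ℂ L] {k : ℕ} {z : L}
    (h : SpansModNext k {z}) : Module.finrank ℂ (lcs L k) ≤ Module.finrank ℂ (lcs L (k + 1)) + 1 := by
  have h1 := Submodule.finrank_mono h
  have h2 := Submodule.finrank_add_le_finrank_add_finrank (lcs L (k + 1)) (Submodule.span ℂ {z})
  have h3 := finrank_span_le_card (R := ℂ) ({z} : Set L)
  simp at h3
  omega

/-- A nonzero linear form on the plane of two generators vanishes on some generator: if the third
term of the series is a line modulo the fourth, one may choose generators `a`, `b` with
`⁅b, ⁅a, b⁆⁆` in the fourth term. -/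
theorem exists_generators_lie_mem [FiniteDimensional ℂ L] {a b : L} (hab : SpansModNext 0 {a, b})
    (h : Module.finrank ℂ (lcs L 2) ≤ Module.finrank ℂ (lcs L 3) + 1) :
    ∃ a b : L, SpansModNext 0 {a, b} ∧ ⁅b, ⁅a, b⁆⁆ ∈ lcs L 3 := by
  by_cases hac : ⁅a, ⁅a, b⁆⁆ ∈ lcs L 3
  · refine ⟨b, a, by rwa [Set.pair_comm], ?_⟩
    rw [← lie_skew b a, lie_neg]
    exact neg_mem hac
  obtain ⟨g, -, hg⟩ := exists_le_sup_span 1 (lcs_antitone (L := L) (Nat.le_succ 2)) h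
  have hg' : lcs L 2 ≤ lcs L 3 ⊔ Submodule.span ℂ {g 0} := by
    rwa [Set.range_unique] at hg
  obtain ⟨u, hu, u', hu', huu⟩ := Submodule.mem_sup.1
    (hg' (lie_mem_lcs_succ a (lie_mem_lcs_one a b)))
  obtain ⟨v, hv, v', hv', hvv⟩ := Submodule.mem_sup.1
    (hg' (lie_mem_lcs_succ b (lie_mem_lcs_one a b)))
  obtain ⟨p, rfl⟩ := Submodule.mem_span_singleton.1 hu'
  obtain ⟨q, rfl⟩ := Submodule.mem_span_singleton.1 hv'
  have hp : p ≠ 0 := by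
    rintro rfl
    rw [← huu, zero_smul, add_zero] at hac
    exact hac hu
  refine ⟨a, b - (q / p) • a, hab.of_subset ?_, ?_⟩
  · have ha : a ∈ (lcs L (0 + 1) ⊔ Submodule.span ℂ {a, b - (q / p) • a} : Submodule ℂ L) :=
      Submodule.mem_sup_right (Submodule.subset_span (by simp))
    have hb : b - (q / p) • a ∈
        (lcs L (0 + 1) ⊔ Submodule.span ℂ {a, b - (q / p) • a} : Submodule ℂ L) :=
      Submodule.mem_sup_right (Submodule.subset_span (by simp))
    rintro _ (rfl | rfl)
    · exact ha
    · simpa using add_mem hb (Submodule.smul_mem _ (q / p) ha)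
  · rw [lie_sub a, lie_smul, lie_self, smul_zero, sub_zero, sub_lie, smul_lie, ← huu, ← hvv]
    have : v + q • g 0 - (q / p) • (u + p • g 0) = v - (q / p) • u := by
      rw [smul_add, smul_smul, div_mul_cancel₀ q hp]
      abel
    rw [this]
    exact sub_mem hv (Submodule.smul_mem _ _ hu)

theorem iso_table_three_of_lie (h5 : Module.finrank ℂ L = 5) {a b c w z : L}
    (hv : ⊤ ≤ Submodule.span ℂ (Set.range ![b, z, w, c, a]))
    (hab : ⁅a, b⁆ = c) (hca : ⁅c, a⁆ = w) (hcb : ⁅c, b⁆ = z)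
    (hw : ∀ x : L, ⁅x, w⁆ = 0) (hw' : ∀ x : L, ⁅w, x⁆ = 0)
    (hz : ∀ x : L, ⁅x, z⁆ = 0) (hz' : ∀ x : L, ⁅z, x⁆ = 0) :
    Iso L (nilpotentTable 3).Alg := by
  refine iso_of_span (nilpotentTable 3) h5 _ hv (forall_lt_fin_five ?_ ?_ ?_ ?_ ?_ ?_ ?_ ?_ ?_ ?_)
    <;> simp [nilpotentTable_br, Fin.sum_univ_five, lie_flip hab, hca, lie_flip hcb,
       hw, hw', hz, hz']

/-- Nilpotency class four: rescaling turns a nonzero `t` into the bracket of `d₁₂(0:0:0)`, and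
`t = 0` gives `d₂₀(0:0:0:0)`. -/
theorem exists_iso_table_of_filiform (h5 : Module.finrank ℂ L = 5) {a b c w z : L} {t : ℂ}
    (hv : ⊤ ≤ Submodule.span ℂ (Set.range ![a, z, w, c, b]))
    (hab : ⁅a, b⁆ = c) (hac : ⁅a, c⁆ = w) (haw : ⁅a, w⁆ = z) (hbc : ⁅b, c⁆ = t • z)
    (hbw : ⁅b, w⁆ = 0) (hcw : ⁅c, w⁆ = 0)
    (hz : ∀ x : L, ⁅x, z⁆ = 0) (hz' : ∀ x : L, ⁅z, x⁆ = 0) :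
    ∃ i, Iso L (nilpotentTable i).Alg := by
  by_cases ht : t = 0
  · subst ht
    refine ⟨5, iso_of_span (nilpotentTable 5) h5 ![-a, z, w, c, b] ?_
      (forall_lt_fin_five ?_ ?_ ?_ ?_ ?_ ?_ ?_ ?_ ?_ ?_)⟩
    · refine top_le_span_of_smul hv id ![-1, 1, 1, 1, 1] fun k => ?_
      fin_cases k <;> simp
    all_goals simp [nilpotentTable_br, Fin.sum_univ_five, hab, hac, haw,
      lie_flip hbc, lie_flip hbw, lie_flip hcw, hz, hz']
  · refine ⟨2, iso_of_span (nilpotentTable 2) h5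
      ![-a, -t⁻¹ • w, -t⁻¹ • z, -t⁻¹ • c, -t⁻¹ • b] ?_
      (forall_lt_fin_five ?_ ?_ ?_ ?_ ?_ ?_ ?_ ?_ ?_ ?_)⟩
    · refine top_le_span_of_smul hv ![0, 2, 1, 3, 4] ![-1, -t, -t, -t, -t] fun k => ?_
      fin_cases k <;> simp [ht, smul_smul]
    all_goals simp [nilpotentTable_br, Fin.sum_univ_five, hab, hac, haw,
      lie_flip hbc, lie_flip hbw, lie_flip hcw, hz, hz', ht, smul_smul]

theorem exists_iso_table_of_finrank_three (h5 : Module.finrank ℂ L = 5)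
    (hL : LieRing.IsNilpotent L) (h1 : Module.finrank ℂ (lcs L 1) = 3) :
    ∃ i, Iso L (nilpotentTable i).Alg := by
  have : FiniteDimensional ℂ L := Module.finite_of_finrank_eq_succ h5
  obtain ⟨a, b, hab⟩ : ∃ a b : L, SpansModNext 0 {a, b} := by
    obtain ⟨g, -, hg⟩ := exists_le_sup_span 2 (le_top : lcs L 1 ≤ ⊤)
      (by rw [finrank_top, h5, h1])
    refine ⟨g 0, g 1, fun x _ => ?_⟩
    have := hg (Submodule.mem_top (x := x))
    rwa [show Set.range g = {g 0, g 1} by ext; simp [Fin.exists_fin_two, eq_comm]] at this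
  have h2 : Module.finrank ℂ (lcs L 2) = 2 := by
    have hlt : Module.finrank ℂ (lcs L 2) < _ := finrank_lcs_succ_lt hL (k := 1) (by omega)
    have hle : _ ≤ Module.finrank ℂ (lcs L 2) + 1 := hab.pair_one.finrank_le_succ
    omega
  have h3 : Module.finrank ℂ (lcs L 3) < _ := finrank_lcs_succ_lt hL (k := 2) (by omega)
  obtain h3 | h3 : Module.finrank ℂ (lcs L 3) = 0 ∨ Module.finrank ℂ (lcs L 3) = 1 := by omega
  · have h3' : lcs L 3 = ⊥ := Submodule.finrank_eq_zero.1 h3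
    have hm := fun x : L => lie_mem_lcs_succ x (lie_mem_lcs_one a b)
    have hm' : ∀ x, ⁅⁅a, b⁆, x⁆ ∈ lcs L 2 := fun x => by
      rw [← lie_skew]
      exact neg_mem (hm x)
    refine ⟨3, iso_table_three_of_lie h5 (a := a) (b := b) ?_ rfl rfl rfl
      (lie_eq_zero_of_mem h3' (hm' a)) (lie_eq_zero_of_mem' h3' (hm' a))
      (lie_eq_zero_of_mem h3' (hm' b)) (lie_eq_zero_of_mem' h3' (hm' b))⟩
    set v := ![b, ⁅⁅a, b⁆, b⁆, ⁅⁅a, b⁆, a⁆, ⁅a, b⁆, a]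
    have hvm : ∀ k, v k ∈ Submodule.span ℂ (Set.range v) := fun k =>
      Submodule.subset_span (Set.mem_range_self k)
    refine hab.le (hab.pair_one.le (hab.pair_two.le (h3'.le.trans bot_le) ?_) ?_) ?_
    · rintro _ (rfl | rfl)
      · rw [← lie_skew]; exact neg_mem (hvm 2)
      · rw [← lie_skew]; exact neg_mem (hvm 1)
    · rintro _ rfl; exact hvm 3
    · rintro _ (rfl | rfl)
      · exact hvm 4
      · exact hvm 0
  · obtain ⟨a, b, hab, hbc⟩ := exists_generators_lie_mem hab (by omega)
    have h4 : lcs L 4 = ⊥ := by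
      have : Module.finrank ℂ (lcs L 4) < _ := finrank_lcs_succ_lt hL (k := 3) (by omega)
      exact Submodule.finrank_eq_zero.1 (by omega)
    have hc := lie_mem_lcs_one a b
    have hw := lie_mem_lcs_succ a hc
    have hz := lie_mem_lcs_succ a hw
    have g2 : SpansModNext 2 {⁅a, ⁅a, b⁆⁆} := by
      refine hab.pair_two.of_subset ?_
      rintro _ (rfl | rfl)
      · exact Submodule.mem_sup_right (Submodule.mem_span_singleton_self _)
      · exact Submodule.mem_sup_left hbc
    -- the Jacobi identity, since `⁅b, ⁅a, b⁆⁆` is central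
    have hbw : ⁅b, ⁅a, ⁅a, b⁆⁆⁆ = 0 := by
      rw [leibniz_lie, lie_eq_zero_of_mem h4 hbc, ← lie_skew b a, neg_lie, lie_self, neg_zero,
        add_zero]
    have hcw : ⁅⁅a, b⁆, ⁅a, ⁅a, b⁆⁆⁆ = 0 := by
      have := lie_mem_lcs_add_two hc hw
      rwa [h4, Submodule.mem_bot] at this
    have g3 : lcs L 3 ≤ Submodule.span ℂ {⁅a, ⁅a, ⁅a, b⁆⁆⁆} := by
      refine (hab.succ g2).le (h4.le.trans bot_le) ?_
      rintro _ ⟨x, (rfl | rfl), y, rfl, rfl⟩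
      · exact Submodule.mem_span_singleton_self _
      · simp only [hbw]
        exact Submodule.zero_mem _
    obtain ⟨t, ht⟩ := Submodule.mem_span_singleton.1 (g3 hbc)
    refine exists_iso_table_of_filiform h5 (a := a) (b := b) ?_ rfl rfl rfl ht.symm hbw hcw
      (lie_eq_zero_of_mem h4 hz) (lie_eq_zero_of_mem' h4 hz)
    set v := ![a, ⁅a, ⁅a, ⁅a, b⁆⁆⁆, ⁅a, ⁅a, b⁆⁆, ⁅a, b⁆, b]
    have hvm : ∀ k, v k ∈ Submodule.span ℂ (Set.range v) := fun k =>
      Submodule.subset_span (Set.mem_range_self k)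
    refine hab.le (hab.pair_one.le (g2.le (g3.trans (Submodule.span_le.2 ?_)) ?_) ?_) ?_
    · rintro _ rfl; exact hvm 1
    · rintro _ rfl; exact hvm 2
    · rintro _ rfl; exact hvm 3
    · rintro _ (rfl | rfl)
      · exact hvm 0
      · exact hvm 4

/-! ### Derived algebra of dimension two -/

/-- Three generators give the derived algebra three generators modulo the next term. -/
theorem SpansModNext.triple_one {a b c : L} (h : SpansModNext 0 {a, b, c}) :
    SpansModNext 1 {⁅a, b⁆, ⁅a, c⁆, ⁅b, c⁆} := by
  refine (h.succ h).of_subset ?_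
  have key : ∀ x y : L, ⁅x, y⁆ ∈ ({⁅a, b⁆, ⁅a, c⁆, ⁅b, c⁆} : Set L) →
      ⁅x, y⁆ ∈ (lcs L (1 + 1) ⊔ Submodule.span ℂ {⁅a, b⁆, ⁅a, c⁆, ⁅b, c⁆} : Submodule ℂ L) ∧
      ⁅y, x⁆ ∈ (lcs L (1 + 1) ⊔ Submodule.span ℂ {⁅a, b⁆, ⁅a, c⁆, ⁅b, c⁆} : Submodule ℂ L) := by
    intro x y hxy
    have h1 := Submodule.mem_sup_right (S := lcs L (1 + 1)) (Submodule.subset_span (R := ℂ) hxy)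
    have h2 := neg_mem h1
    rw [lie_skew] at h2
    exact ⟨h1, h2⟩
  rintro _ ⟨x, (rfl | rfl | rfl), y, (rfl | rfl | rfl), rfl⟩
  · simp
  · exact (key _ _ (by simp)).1
  · exact (key _ _ (by simp)).1
  · exact (key _ _ (by simp)).2
  · simp
  · exact (key _ _ (by simp)).1
  · exact (key _ _ (by simp)).2
  · exact (key _ _ (by simp)).2
  · simp

/-- A change of generators is admissible as soon as the old ones lie in the span of the new ones and
the derived algebra. -/
theorem SpansModNext.change_triple {k : ℕ} {a b c a' b' c' : L} (h : SpansModNext k {a, b, c})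
    (hT : ∀ T : Submodule ℂ L, lcs L (k + 1) ≤ T → a' ∈ T → b' ∈ T → c' ∈ T →
      a ∈ T ∧ b ∈ T ∧ c ∈ T) : SpansModNext k {a', b', c'} := by
  obtain ⟨ha, hb, hc⟩ := hT (lcs L (k + 1) ⊔ Submodule.span ℂ {a', b', c'}) le_sup_left
    (Submodule.mem_sup_right (Submodule.subset_span (by simp)))
    (Submodule.mem_sup_right (Submodule.subset_span (by simp)))
    (Submodule.mem_sup_right (Submodule.subset_span (by simp)))
  refine h.of_subset ?_
  rintro _ (rfl | rfl | rfl) <;> assumption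

/-- A relation between the brackets of three generators whose first coefficient is nonzero is
`⁅a', b'⁆ = 0` for modified generators, because every bivector in dimension three is
decomposable. -/
theorem exists_commuting_generators {a b c : L} (h : SpansModNext 0 {a, b, c}) {p q r : ℂ}
    (hp : p ≠ 0) (hrel : p • ⁅a, b⁆ + q • ⁅a, c⁆ + r • ⁅b, c⁆ = 0) :
    ∃ a b c : L, SpansModNext 0 {a, b, c} ∧ ⁅a, b⁆ = 0 := by
  refine ⟨a - (r / p) • c, b + (q / p) • c, c, h.change_triple fun T _ ha hb hc => ⟨?_, ?_, hc⟩, ?_⟩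
  · simpa using add_mem ha (T.smul_mem (r / p) hc)
  · simpa using sub_mem hb (T.smul_mem (q / p) hc)
  · have h1 : ⁅a - (r / p) • c, b + (q / p) • c⁆ =
        p⁻¹ • (p • ⁅a, b⁆ + q • ⁅a, c⁆ + r • ⁅b, c⁆) := by
      rw [sub_lie, lie_add, lie_add, smul_lie, smul_lie, lie_smul, lie_smul, lie_self,
        ← lie_skew c b, smul_add, smul_add, smul_smul, smul_smul, smul_smul, inv_mul_cancel₀ hp,
        one_smul, div_eq_inv_mul, div_eq_inv_mul]
      module
    rw [h1, hrel, smul_zero]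

theorem iso_table_six_of_lie (h5 : Module.finrank ℂ L = 5) {a b c : L}
    (hv : ⊤ ≤ Submodule.span ℂ (Set.range ![c, ⁅a, c⁆, a, ⁅b, c⁆, b])) (hab : ⁅a, b⁆ = 0)
    (hz : ∀ x y z : L, ⁅x, ⁅y, z⁆⁆ = 0) : Iso L (nilpotentTable 6).Alg := by
  have hz' : ∀ x y z : L, ⁅⁅y, z⁆, x⁆ = 0 := fun x y z => by rw [← lie_skew, hz, neg_zero]
  refine iso_of_span (nilpotentTable 6) h5 _ hv (forall_lt_fin_five ?_ ?_ ?_ ?_ ?_ ?_ ?_ ?_ ?_ ?_)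
    <;> simp [nilpotentTable_br, Fin.sum_univ_five, hab, hz, hz', -lie_lie]

theorem iso_table_six_of_class_two (h5 : Module.finrank ℂ L = 5)
    (h1 : Module.finrank ℂ (lcs L 1) = 2) (h2 : lcs L 2 = ⊥) {a b c : L}
    (h : SpansModNext 0 {a, b, c}) : Iso L (nilpotentTable 6).Alg := by
  have : FiniteDimensional ℂ L := Module.finite_of_finrank_eq_succ h5
  have hli : ¬ LinearIndependent ℂ ![⁅a, b⁆, ⁅a, c⁆, ⁅b, c⁆] := by
    intro hli
    have hle : Submodule.span ℂ (Set.range ![⁅a, b⁆, ⁅a, c⁆, ⁅b, c⁆]) ≤ lcs L 1 := by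
      rw [Submodule.span_le]
      rintro _ ⟨k, rfl⟩
      fin_cases k <;> exact lie_mem_lcs_one _ _
    have := Submodule.finrank_mono hle
    rw [finrank_span_eq_card hli, h1] at this
    simp at this
  obtain ⟨g, hg, k, hk⟩ := Fintype.not_linearIndependent_iff.1 hli
  simp only [Fin.sum_univ_three, Matrix.cons_val] at hg
  obtain ⟨a, b, c, h, hab⟩ : ∃ a b c : L, SpansModNext 0 {a, b, c} ∧ ⁅a, b⁆ = 0 := by
    fin_cases k
    · exact exists_commuting_generators h hk hg
    · refine exists_commuting_generators (a := a) (b := c) (c := b) (p := g 1) (q := g 0)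
        (r := -g 2) (h.change_triple fun T _ ha hc hb => ⟨ha, hb, hc⟩) hk ?_
      rw [← hg, ← lie_skew c b]
      module
    · refine exists_commuting_generators (a := b) (b := c) (c := a) (p := g 2) (q := -g 0)
        (r := -g 1) (h.change_triple fun T _ hb hc ha => ⟨ha, hb, hc⟩) hk ?_
      rw [← hg, ← lie_skew b a, ← lie_skew c a]
      module
  have hz : ∀ x y z : L, ⁅x, ⁅y, z⁆⁆ = 0 := fun x y z =>
    lie_eq_zero_of_mem h2 (lie_mem_lcs_one y z) x
  refine iso_table_six_of_lie h5 (a := a) (b := b) (c := c) ?_ hab hz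
  set v := ![c, ⁅a, c⁆, a, ⁅b, c⁆, b]
  have hvm : ∀ k, v k ∈ Submodule.span ℂ (Set.range v) := fun k =>
    Submodule.subset_span (Set.mem_range_self k)
  refine h.le (h.triple_one.le (h2.le.trans bot_le) ?_) ?_
  · rintro _ (rfl | rfl | rfl)
    · rw [hab]; exact Submodule.zero_mem _
    · exact hvm 1
    · exact hvm 3
  · rintro _ (rfl | rfl | rfl)
    · exact hvm 2
    · exact hvm 4
    · exact hvm 0

/-- Rescaling turns a nonzero `t` into the bracket of `d₅(0:0:0)`, and `t = 0` gives
`d₂₁(0:0:0)`. -/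
theorem exists_iso_table_of_class_three (h5 : Module.finrank ℂ L = 5) {a b c y z : L} {t : ℂ}
    (hv : ⊤ ≤ Submodule.span ℂ (Set.range ![a, c, z, y, b]))
    (hab : ⁅a, b⁆ = y) (hay : ⁅a, y⁆ = z) (hac : ⁅a, c⁆ = 0) (hbc : ⁅b, c⁆ = t • z)
    (hby : ⁅b, y⁆ = 0) (hcy : ⁅c, y⁆ = 0)
    (hz : ∀ x : L, ⁅x, z⁆ = 0) (hz' : ∀ x : L, ⁅z, x⁆ = 0) :
    ∃ i, Iso L (nilpotentTable i).Alg := by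
  by_cases ht : t = 0
  · subst ht
    refine ⟨1, iso_of_span (nilpotentTable 1) h5 ![-a, c, z, y, b] ?_
      (forall_lt_fin_five ?_ ?_ ?_ ?_ ?_ ?_ ?_ ?_ ?_ ?_)⟩
    · refine top_le_span_of_smul hv id ![-1, 1, 1, 1, 1] fun k => ?_
      fin_cases k <;> simp
    all_goals simp [nilpotentTable_br, Fin.sum_univ_five, hab, hay, hac, lie_flip hbc,
      lie_flip hby, hcy, hz, hz']
  · refine ⟨0, iso_of_span (nilpotentTable 0) h5 ![t⁻¹ • c, z, y, b, -a] ?_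
      (forall_lt_fin_five ?_ ?_ ?_ ?_ ?_ ?_ ?_ ?_ ?_ ?_)⟩
    · refine top_le_span_of_smul hv ![4, 0, 1, 2, 3] ![-1, t, 1, 1, 1] fun k => ?_
      fin_cases k <;> simp [ht, smul_smul]
    all_goals simp [nilpotentTable_br, Fin.sum_univ_five, lie_flip hab, lie_flip hay,
      lie_flip hac, lie_flip hbc, lie_flip hby, hcy, hz, hz', ht, smul_smul]

theorem SpansModNext.exists_eq_add_smul {k : ℕ} {y u : L} (h : SpansModNext k {y})
    (hu : u ∈ lcs L k) : ∃ m ∈ lcs L (k + 1), ∃ p : ℂ, u = m + p • y := by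
  obtain ⟨m, hm, w, hw, rfl⟩ := Submodule.mem_sup.1 (h hu)
  obtain ⟨p, rfl⟩ := Submodule.mem_span_singleton.1 hw
  exact ⟨m, hm, p, rfl⟩

theorem SpansModNext.lie_eq_zero {y u x : L} (h3 : lcs L 3 = ⊥) (h : SpansModNext 1 {y})
    (hx : ⁅x, y⁆ = 0) (hu : u ∈ lcs L 1) : ⁅x, u⁆ = 0 := by
  obtain ⟨m, hm, p, rfl⟩ := h.exists_eq_add_smul hu
  rw [lie_add, lie_smul, hx, lie_eq_zero_of_mem h3 hm, smul_zero, add_zero]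

/-- If `b` and `c` centralize the derived algebra, then `a` centralizes `⁅b, c⁆` by the Jacobi
identity; as `a` does not centralize `y`, the bracket `⁅b, c⁆` has no `y`-component. -/
theorem SpansModNext.lie_mem_lcs_two {a b c y : L} (h3 : lcs L 3 = ⊥) (h : SpansModNext 1 {y})
    (hay : ⁅a, y⁆ ≠ 0) (hby : ⁅b, y⁆ = 0) (hcy : ⁅c, y⁆ = 0) : ⁅b, c⁆ ∈ lcs L 2 := by
  obtain ⟨m, hm, p, hpm⟩ := h.exists_eq_add_smul (lie_mem_lcs_one b c)
  have hj : ⁅a, ⁅b, c⁆⁆ = 0 := by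
    rw [leibniz_lie, h.lie_eq_zero h3 hby (lie_mem_lcs_one a c), ← lie_skew,
      h.lie_eq_zero h3 hcy (lie_mem_lcs_one a b), neg_zero, add_zero]
  rw [hpm, lie_add, lie_eq_zero_of_mem h3 hm, zero_add, lie_smul, smul_eq_zero] at hj
  rw [hpm, hj.resolve_right hay, zero_smul, add_zero]
  exact hm

/-- The case in which the second term `lcs L 2` is a line, the generators `b` and `c` commute with
an element `y` that spans the derived algebra modulo that line, and `⁅a, b⁆` lies outside it as well. -/
theorem exists_iso_table_of_centralizing (h5 : Module.finrank ℂ L = 5)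
    (h2 : Module.finrank ℂ (lcs L 2) = 1) (h3 : lcs L 3 = ⊥) {a b c y : L}
    (h : SpansModNext 0 {a, b, c}) (hy : SpansModNext 1 {y}) (hay : ⁅a, y⁆ ≠ 0)
    (hby : ⁅b, y⁆ = 0)
    (hcy : ⁅c, y⁆ = 0) (hab : ⁅a, b⁆ ∉ lcs L 2) : ∃ i, Iso L (nilpotentTable i).Alg := by
  have : FiniteDimensional ℂ L := Module.finite_of_finrank_eq_succ h5
  have hz := fun {u : L} (hu : u ∈ lcs L 2) (x : L) => lie_eq_zero_of_mem h3 hu x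
  have hbc : ⁅b, c⁆ ∈ lcs L 2 := hy.lie_mem_lcs_two h3 hay hby hcy
  obtain ⟨m, hm, p, hpm⟩ := hy.exists_eq_add_smul (lie_mem_lcs_one a b)
  have hp : p ≠ 0 := by
    rintro rfl
    rw [hpm, zero_smul, add_zero] at hab
    exact hab hm
  have hby' : ⁅b, ⁅a, b⁆⁆ = 0 := hy.lie_eq_zero h3 hby (lie_mem_lcs_one a b)
  have hcy' : ⁅c, ⁅a, b⁆⁆ = 0 := hy.lie_eq_zero h3 hcy (lie_mem_lcs_one a b)
  have hz0 : ⁅a, ⁅a, b⁆⁆ ≠ 0 := by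
    rw [hpm, lie_add, hz hm, zero_add, lie_smul]
    exact smul_ne_zero hp hay
  have hzm : ⁅a, ⁅a, b⁆⁆ ∈ lcs L 2 := lie_mem_lcs_succ a (lie_mem_lcs_one a b)
  have g2 := le_span_singleton_of_finrank_eq_one h2 hzm hz0
  have g1 : SpansModNext 1 {⁅a, b⁆} := by
    refine hy.of_subset (Set.singleton_subset_iff.2 ?_)
    change y ∈ (lcs L (1 + 1) ⊔ Submodule.span ℂ {⁅a, b⁆} : Submodule ℂ L)
    have : y = p⁻¹ • (⁅a, b⁆ - m) := by
      rw [hpm, add_sub_cancel_left, smul_smul, inv_mul_cancel₀ hp, one_smul]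
    rw [this]
    exact Submodule.smul_mem _ _ (sub_mem (Submodule.mem_sup_right
      (Submodule.mem_span_singleton_self _)) (Submodule.mem_sup_left hm))
  -- remove the components of `⁅a, c⁆` by subtracting multiples of `b` and `⁅a, b⁆` from `c`
  obtain ⟨n, hn, r, hr⟩ := g1.exists_eq_add_smul (lie_mem_lcs_one a c)
  obtain ⟨s, rfl⟩ := Submodule.mem_span_singleton.1 (g2 hn)
  obtain ⟨t, ht⟩ := Submodule.mem_span_singleton.1 (g2 hbc)
  refine exists_iso_table_of_class_three h5 (a := a) (b := b) (c := c - r • b - s • ⁅a, b⁆) (t := t) ?_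
    rfl rfl ?_ ?_ hby' ?_ (lie_eq_zero_of_mem h3 hzm) (lie_eq_zero_of_mem' h3 hzm)
  · set v := ![a, c - r • b - s • ⁅a, b⁆, ⁅a, ⁅a, b⁆⁆, ⁅a, b⁆, b]
    have hvm : ∀ k, v k ∈ Submodule.span ℂ (Set.range v) := fun k =>
      Submodule.subset_span (Set.mem_range_self k)
    refine h.le (g1.le (g2.trans (Submodule.span_le.2 ?_)) ?_) ?_
    · rintro _ rfl; exact hvm 2
    · rintro _ rfl; exact hvm 3
    · rintro _ (rfl | rfl | hc)
      · exact hvm 0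
      · exact hvm 4
      · rw [hc]
        have : c = v 1 + r • v 4 + s • v 3 := by simp only [v, Matrix.cons_val]; abel
        exact this ▸ add_mem (add_mem (hvm 1) (Submodule.smul_mem _ _ (hvm 4)))
          (Submodule.smul_mem _ _ (hvm 3))
  · rw [lie_sub, lie_sub, lie_smul, lie_smul, hr]
    abel
  · rw [lie_sub, lie_sub, lie_smul, lie_smul, hby', lie_self, ht]
    simp
  · rw [sub_lie, sub_lie, smul_lie, smul_lie, hby', hcy', lie_self]
    simp

theorem exists_iso_table_of_finrank_two (h5 : Module.finrank ℂ L = 5)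
    (hL : LieRing.IsNilpotent L) (h1 : Module.finrank ℂ (lcs L 1) = 2) :
    ∃ i, Iso L (nilpotentTable i).Alg := by
  have : FiniteDimensional ℂ L := Module.finite_of_finrank_eq_succ h5
  obtain ⟨a, b, c, h⟩ : ∃ a b c : L, SpansModNext 0 {a, b, c} := by
    obtain ⟨g, -, hg⟩ := exists_le_sup_span 3 (le_top : lcs L 1 ≤ ⊤)
      (by rw [finrank_top, h5, h1])
    refine ⟨g 0, g 1, g 2, fun x _ => ?_⟩
    have := hg (Submodule.mem_top (x := x))
    rwa [show Set.range g = {g 0, g 1, g 2} by ext; simp [Fin.exists_fin_succ, eq_comm]] at this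
  have h2 : Module.finrank ℂ (lcs L 2) < _ := finrank_lcs_succ_lt hL (k := 1) (by omega)
  obtain h2 | h2 : Module.finrank ℂ (lcs L 2) = 0 ∨ Module.finrank ℂ (lcs L 2) = 1 := by omega
  · exact ⟨6, iso_table_six_of_class_two h5 h1 (Submodule.finrank_eq_zero.1 h2) h⟩
  have h3 : lcs L 3 = ⊥ := by
    have : Module.finrank ℂ (lcs L 3) < _ := finrank_lcs_succ_lt hL (k := 2) (by omega)
    exact Submodule.finrank_eq_zero.1 (by omega)
  obtain ⟨g, hgm, hg⟩ := exists_le_sup_span 1 (lcs_antitone (L := L) (Nat.le_succ 1))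
    (by rw [h1, h2])
  have hym : g 0 ∈ lcs L 1 := hgm 0
  have hy : SpansModNext 1 {g 0} := by rwa [Set.range_unique] at hg
  generalize g 0 = y at hym hy
  -- some generator does not commute with `y`; it becomes the first one
  obtain ⟨a, b, c, h, hay⟩ : ∃ a b c : L, SpansModNext 0 {a, b, c} ∧ ⁅a, y⁆ ≠ 0 := by
    by_contra! hcon
    have ha := hcon a b c h
    have hb := hcon b a c (h.change_triple fun T _ hb ha hc => ⟨ha, hb, hc⟩)
    have hc := hcon c a b (h.change_triple fun T _ hc ha hb => ⟨ha, hb, hc⟩)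
    have : lcs L 2 ≤ ⊥ := by
      refine (h.succ hy).le h3.le ?_
      rintro _ ⟨x, (rfl | rfl | rfl), u, rfl, rfl⟩ <;> simpa
    rw [le_bot_iff.1 this] at h2
    simp at h2
  have g2 := le_span_singleton_of_finrank_eq_one h2 (lie_mem_lcs_succ a hym) hay
  -- the other two generators can be chosen to commute with `y`
  obtain ⟨b, c, h, hby, hcy⟩ :
      ∃ b c : L, SpansModNext 0 {a, b, c} ∧ ⁅b, y⁆ = 0 ∧ ⁅c, y⁆ = 0 := by
    obtain ⟨p, hp⟩ := Submodule.mem_span_singleton.1 (g2 (lie_mem_lcs_succ b hym))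
    obtain ⟨q, hq⟩ := Submodule.mem_span_singleton.1 (g2 (lie_mem_lcs_succ c hym))
    refine ⟨b - p • a, c - q • a, h.change_triple fun T _ ha hb hc => ⟨ha, ?_, ?_⟩, ?_, ?_⟩
    · simpa using add_mem hb (T.smul_mem p ha)
    · simpa using add_mem hc (T.smul_mem q ha)
    · rw [sub_lie, smul_lie, hp, sub_self]
    · rw [sub_lie, smul_lie, hq, sub_self]
  by_cases hab : ⁅a, b⁆ ∈ lcs L 2
  · by_cases hac : ⁅a, c⁆ ∈ lcs L 2
    · -- otherwise the derived algebra would be spanned by `⁅b, c⁆`, which lies in `lcs L 2`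
      exfalso
      have h12 : lcs L 1 ≤ lcs L 2 := by
        refine h.triple_one.le le_rfl ?_
        rintro _ (rfl | rfl | rfl)
        · exact hab
        · exact hac
        · exact hy.lie_mem_lcs_two h3 hay hby hcy
      rw [lcs_eq_bot_of_le_succ hL h12] at h1
      simp at h1
    · exact exists_iso_table_of_centralizing h5 h2 h3
        (h.change_triple fun T _ ha hc hb => ⟨ha, hb, hc⟩) hy hay hcy hby hac
  · exact exists_iso_table_of_centralizing h5 h2 h3 h hy hay hby hcy hab

/-! ### Derived algebra of dimension one -/

theorem exists_iso_table_of_finrank_one (h5 : Module.finrank ℂ L = 5)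
    (hL : LieRing.IsNilpotent L) (h1 : Module.finrank ℂ (lcs L 1) = 1) :
    ∃ i, Iso L (nilpotentTable i).Alg := by
  have : FiniteDimensional ℂ L := Module.finite_of_finrank_eq_succ h5
  have h2 : lcs L 2 = ⊥ := by
    have : Module.finrank ℂ (lcs L 2) < _ := finrank_lcs_succ_lt hL (k := 1) (by omega)
    exact Submodule.finrank_eq_zero.1 (by omega)
  have hz : ∀ x y w : L, ⁅w, ⁅x, y⁆⁆ = 0 := fun x y w =>
    lie_eq_zero_of_mem h2 (lie_mem_lcs_one x y) w
  have hz' : ∀ x y w : L, ⁅⁅x, y⁆, w⁆ = 0 := fun x y w =>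
    lie_eq_zero_of_mem' h2 (lie_mem_lcs_one x y) w
  obtain ⟨x, y, hxy⟩ : ∃ x y : L, ⁅x, y⁆ ≠ 0 := by
    by_contra! hcon
    have : lcs L 1 ≤ ⊥ := lcs_succ_le fun x y _ => by simp [hcon x y]
    rw [le_bot_iff.1 this] at h1
    simp at h1
  have hspan : ∀ u v : L, ∃ t : ℂ, t • ⁅x, y⁆ = ⁅u, v⁆ := fun u v =>
    Submodule.mem_span_singleton.1
      (le_span_singleton_of_finrank_eq_one h1 (lie_mem_lcs_one x y) hxy (lie_mem_lcs_one u v))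
  have hli := linearIndependent_of_lie_ne_zero hxy (hz x y) hxy
  obtain ⟨g, -, hg⟩ := exists_le_sup_span 2
    (le_top : Submodule.span ℂ (Set.range ![x, y, ⁅x, y⁆]) ≤ ⊤)
    (by rw [finrank_top, h5, finrank_span_eq_card hli, Fintype.card_fin])
  -- correct the two complementary vectors so that they commute with `x` and `y`
  have hcor : ∀ w : L, ∃ p q : ℂ, ⁅x, w - p • y + q • x⁆ = 0 ∧ ⁅y, w - p • y + q • x⁆ = 0 := by
    intro w
    obtain ⟨p, hp⟩ := hspan x w
    obtain ⟨q, hq⟩ := hspan y w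
    refine ⟨p, q, ?_, ?_⟩
    · simp [← hp]
    · rw [lie_add, lie_sub, lie_smul, lie_smul, lie_self, ← hq, ← lie_skew y x]
      module
  obtain ⟨p, q, hxu, hyu⟩ := hcor (g 0)
  obtain ⟨p', q', hxv, hyv⟩ := hcor (g 1)
  set u := g 0 - p • y + q • x with hu
  set w := g 1 - p' • y + q' • x with hw
  have htop : ⊤ ≤ Submodule.span ℂ (Set.range ![y, u, w, ⁅x, y⁆, x]) := by
    set v := ![y, u, w, ⁅x, y⁆, x] with hv
    have hvm : ∀ k, v k ∈ Submodule.span ℂ (Set.range v) := fun k =>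
      Submodule.subset_span (Set.mem_range_self k)
    refine hg.trans (sup_le (Submodule.span_le.2 ?_) (Submodule.span_le.2 ?_))
    · rintro _ ⟨k, rfl⟩
      fin_cases k
      · exact hvm 4
      · exact hvm 0
      · exact hvm 3
    · rintro _ ⟨k, rfl⟩
      fin_cases k
      · have : g 0 = v 1 + p • v 0 - q • v 4 := by simp only [hv, hu, Matrix.cons_val]; abel
        change g 0 ∈ _
        rw [this]
        exact sub_mem (add_mem (hvm 1) (Submodule.smul_mem _ _ (hvm 0)))
          (Submodule.smul_mem _ _ (hvm 4))
      · have : g 1 = v 2 + p' • v 0 - q' • v 4 := by simp only [hv, hw, Matrix.cons_val]; abel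
        change g 1 ∈ _
        rw [this]
        exact sub_mem (add_mem (hvm 2) (Submodule.smul_mem _ _ (hvm 0)))
          (Submodule.smul_mem _ _ (hvm 4))
  clear_value u w
  obtain ⟨t, ht⟩ := hspan u w
  by_cases ht0 : t = 0
  · subst ht0
    rw [zero_smul] at ht
    refine ⟨7, iso_of_span (nilpotentTable 7) h5 _ htop
      (forall_lt_fin_five ?_ ?_ ?_ ?_ ?_ ?_ ?_ ?_ ?_ ?_)⟩ <;>
    simp [nilpotentTable_br, Fin.sum_univ_five, hz, hz', -lie_lie, hyu, hyv, ← ht, lie_flip hxu,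
      lie_flip hxv]
  · refine ⟨4, iso_of_span (nilpotentTable 4) h5 ![t⁻¹ • w, u, ⁅x, y⁆, x, y] ?_
      (forall_lt_fin_five ?_ ?_ ?_ ?_ ?_ ?_ ?_ ?_ ?_ ?_)⟩
    · refine top_le_span_of_smul htop ![4, 1, 0, 2, 3] ![1, 1, t, 1, 1] fun k => ?_
      fin_cases k <;> simp [ht0, smul_smul]
    all_goals simp [nilpotentTable_br, Fin.sum_univ_five, hz, hz', -lie_lie,
      lie_flip ht.symm, lie_flip hxu, lie_flip hxv, lie_flip hyu, lie_flip hyv, ht0, smul_smul]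

/-! ### The classification -/

theorem iso_table_eight (h5 : Module.finrank ℂ L = 5) (h1 : lcs L 1 = ⊥) :
    Iso L (nilpotentTable 8).Alg := by
  have : FiniteDimensional ℂ L := Module.finite_of_finrank_eq_succ h5
  let b := Module.finBasisOfFinrankEq ℂ L h5
  refine iso_of_span (nilpotentTable 8) h5 b b.span_eq.ge fun i j _ => ?_
  have h0 : ⁅b i, b j⁆ = 0 := by
    have := lie_mem_lcs_one (b i) (b j)
    rwa [h1, Submodule.mem_bot] at this
  rw [h0, nilpotentTable_br]
  simp [Fin.sum_univ_five]

/-- A nilpotent Lie algebra is not generated by one element unless it is at most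
one-dimensional. -/
theorem finrank_lcs_one_le_three (h5 : Module.finrank ℂ L = 5) (hL : LieRing.IsNilpotent L) :
    Module.finrank ℂ (lcs L 1) ≤ 3 := by
  have : FiniteDimensional ℂ L := Module.finite_of_finrank_eq_succ h5
  by_contra! hcon
  obtain ⟨g, -, hg⟩ := exists_le_sup_span 1 (le_top : lcs L 1 ≤ ⊤) (by rw [finrank_top, h5]; omega)
  have h : SpansModNext 0 {g 0} := by
    rw [Set.range_unique] at hg
    exact fun x _ => hg Submodule.mem_top
  have h12 : lcs L 1 ≤ lcs L 2 := by
    refine (h.succ h).le le_rfl ?_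
    rintro _ ⟨x, rfl, y, rfl, rfl⟩
    simp
  rw [lcs_eq_bot_of_le_succ hL h12] at hcon
  simp at hcon

theorem exists_iso_table (h5 : Module.finrank ℂ L = 5) (hL : LieRing.IsNilpotent L) :
    ∃ i, Iso L (nilpotentTable i).Alg := by
  have : FiniteDimensional ℂ L := Module.finite_of_finrank_eq_succ h5
  have h3 := finrank_lcs_one_le_three h5 hL
  obtain h | h | h | h : Module.finrank ℂ (lcs L 1) = 0 ∨ Module.finrank ℂ (lcs L 1) = 1 ∨
      Module.finrank ℂ (lcs L 1) = 2 ∨ Module.finrank ℂ (lcs L 1) = 3 := by omega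
  · exact ⟨8, iso_table_eight h5 (Submodule.finrank_eq_zero.1 h)⟩
  · exact exists_iso_table_of_finrank_one h5 hL h
  · exact exists_iso_table_of_finrank_two h5 hL h
  · exact exists_iso_table_of_finrank_three h5 hL h

theorem exists_iso_generic_iff (h5 : Module.finrank ℂ L = 5) (hL : LieRing.IsNilpotent L) :
    (∃ F : Family, Iso L F.generic.Alg) ↔ ¬ IsLieAbelian L ∧ ¬ Iso L d19.Alg := by
  rw [exists_iso_generic_iff_table]
  constructor
  · rintro ⟨i, h4, h8, h⟩
    exact ⟨fun hab => h8 ((isLieAbelian_table i).1 (h.isLieAbelian hab)),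
      fun h19 => h4 (eq_of_iso_table i 4 (h.symm.trans h19))⟩
  · rintro ⟨hab, h19⟩
    obtain ⟨i, h⟩ := exists_iso_table h5 hL
    refine ⟨i, ?_, ?_, h⟩ <;> rintro rfl
    · exact h19 h
    · exact hab (h.symm.isLieAbelian ((isLieAbelian_table 8).2 rfl))

end Classification

end Lie5

theorem mainTheorem4 :
    -- the nine structures of the table are nilpotent and pairwise nonisomorphic
    (∀ i : Fin 9, LieRing.IsNilpotent (Lie5.nilpotentTable i).Alg) ∧
    (∀ i j : Fin 9,
      Lie5.Iso (Lie5.nilpotentTable i).Alg (Lie5.nilpotentTable j).Alg → i = j) ∧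
    -- every nilpotent 5-dimensional complex Lie algebra is isomorphic to one of them
    (∀ (L : Type*) [LieRing L] [LieAlgebra ℂ L], Module.finrank ℂ L = 5 →
      LieRing.IsNilpotent L → ∃ i : Fin 9, Lie5.Iso L (Lie5.nilpotentTable i).Alg) ∧
    -- exactly three of them are decomposable, so that six are indecomposable
    (∀ i : Fin 9, Lie5.IsDecomposable (Lie5.nilpotentTable i).Alg ↔ i = 1 ∨ i = 7 ∨ i = 8) ∧
    -- the families consist of solvable algebras, and their generic elements are nilpotent
    (∀ (F : Lie5.Family) (a : Fin F.arity → ℂ), LieAlgebra.IsSolvable (F.member a).Alg) ∧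
    (∀ F : Lie5.Family, LieRing.IsNilpotent F.generic.Alg) ∧
    -- the coincidences
    (Lie5.Iso (Lie5.d5 0 0 0).Alg (Lie5.d14 0 0).Alg ∧
      Lie5.Iso (Lie5.d14 0 0).Alg (Lie5.d15 0 0).Alg) ∧
    Lie5.Iso (Lie5.d6 0 0).Alg (Lie5.d21 0 0 0).Alg ∧
    Lie5.Iso (Lie5.d9 0 0).Alg (Lie5.d12 0 0 0).Alg ∧
    -- `d19` is isomorphic to no member of a family
    (∀ (F : Lie5.Family) (a : Fin F.arity → ℂ), ¬ Lie5.Iso Lie5.d19.Alg (F.member a).Alg) ∧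
    -- the nonabelian nilpotent algebras other than `d19` are exactly, up to isomorphism,
    -- the generic elements of the families
    (∀ (L : Type*) [LieRing L] [LieAlgebra ℂ L], Module.finrank ℂ L = 5 →
      LieRing.IsNilpotent L →
      ((∃ F : Lie5.Family, Lie5.Iso L F.generic.Alg) ↔
        ¬ IsLieAbelian L ∧ ¬ Lie5.Iso L Lie5.d19.Alg)) := by
  refine ⟨Lie5.isNilpotent_table, Lie5.eq_of_iso_table, ?_, Lie5.isDecomposable_table,
    Lie5.isSolvable_member, Lie5.isNilpotent_generic,
    ⟨Lie5.iso_d14_d5.symm, Lie5.iso_d14_d15⟩, Lie5.iso_d6_d21, Lie5.iso_d9_d12,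
    Lie5.not_iso_d19_member, ?_⟩
  · intro L _ _ h5 hL
    exact Lie5.exists_iso_table h5 hL
  · intro L _ _ h5 hL
    exact Lie5.exists_iso_generic_iff h5 hL
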